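/- Write $f_C(x;\lambda)=\frac{1}{\lambda\pi}\frac{1}{1+(x/\lambda)^2}$ and $F_C(x;\lambda)=\frac12+\frac1\pi\arctan(x/\lambda)$ for the density and CDF of the zero-mean Cauchy distribution with scale $\lambda>0$, and $f_G(x;\sigma)$, $F_G(x;\sigma)$ for the density and CDF of the zero-mean Gaussian distribution with standard deviation $\sigma>0$. A probability distribution on $\mathbb R$ is called *symmetric unimodal* (s.u.) if it has a density that is even and nonincreasing on $(0,\infty)$. A CDF $F_{ob}$ *overbounds* a CDF $F$ if $F_{ob}(x)\ge F(x)$ whenever $F(x)\le\frac12$ and $F_{ob}(x)\le F(x)$ whenever $F(x)>\frac12$. Let $\varepsilon_1,\dots,\varepsilon_N$ be independent real random variables whose distributions are s.u., with CDFs $F_{e,1},\dots,F_{e,N}$, and let $S_1,\dots,S_N\in\mathbb R$. For each $i$ suppose that $\sigma_i$ is the least $\sigma>0$ with $$F_G(x;\sigma)\ge F_{e,i}(x)\ \ (x\le 0),\qquad F_G(x;\sigma)\le F_{e,i}(x)\ \ (x>0),$$ and that $\lambda_i$ is the least $\lambda>0$ with $$F_C(x;\lambda)\ge F_{e,i}(x)\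 \ (x\le 0),\qquad F_C(x;\lambda)\le F_{e,i}(x)\ \ (x>0),\qquad \lambda\le\sqrt{2/\pi}\,\sigma_i .$$ Call $(x_1,x_2)$ a *tangent pair* for $i$ if $0<x_1<x_2$ and $$f_C(x_1;\lambda_i)=f_G(x_2;\sigma_i)=\frac{F_G(x_2;\sigma_i)-F_C(x_1;\lambda_i)}{x_2-x_1}.$$ (1) For each $i$, a tangent pair exists if and only if $F_C(\cdot;\lambda_i)$ does not overbound $F_G(\cdot;\sigma_i)$. (2) For each $i$ let $(x_{1,i},x_{2,i})$ be a tangent pair, put $K_i=f_C(x_{1,i};\lambda_i)$, and define $$T_{R,i}(x)=K_i(x-x_{1,i})+F_C(x_{1,i};\lambda_i)\ \ (x_{1,i}\le x\le x_{2,i}),\qquad T_{L,i}(x)=K_i(x+x_{1,i})+F_C(-x_{1,i};\lambda_i)\ \ (-x_{2,i}\le x\le -x_{1,i}),$$ $$F_{ob,i}(x)=\begin{cases}\min\big(F_C(x;\lambda_i),\,T_{L,i}(x),\,F_G(x;\sigma_i)\big), & x\le 0,\\ \max\big(F_C(x;\lambda_i),\,T_{R,i}(x),\,F_G(x;\sigma_i)\big),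 & x>0,\end{cases}$$ where $T_{L,i}$ and $T_{R,i}$ enter only on the intervals on which they are defined. Then for each $i$: (a) $F_{ob,i}(x)=F_C(x;\lambda_i)$ for $|x|\le x_{1,i}$, $F_{ob,i}=T_{R,i}$ on $[x_{1,i},x_{2,i}]$, $F_{ob,i}=T_{L,i}$ on $[-x_{2,i},-x_{1,i}]$, and $F_{ob,i}(x)=F_G(x;\sigma_i)$ for $|x|\ge x_{2,i}$; (b) $F_{ob,i}$ is the CDF of a symmetric unimodal probability distribution; (c) $F_{ob,i}$ overbounds $F_{e,i}$. Moreover, (d): let $\nu_i$ be the probability distribution with CDF $F_{ob,i}$, and let $\nu$ be the convolution over $i=1,\dots,N$ of the images of $\nu_i$ under $x\mapsto |S_i|x$ (when all $S_i\neq0$, $\nu$ has as density the convolution of the functions $x\mapsto |S_i|^{-1}f_{ob,i}(x/|S_i|)$, where $f_{ob,i}$ is a density of $\nu_i$). Then the CDF of $\nu$ overbounds the CDF of the position-domain error $\sum_{i=1}^N S_i\varepsilon_i$. -/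

import Mathlib

namespace CauchyGaussian

open MeasureTheory ProbabilityTheory

/-- PDF of the zero-mean Cauchy distribution `C(0, lam)`. -/
noncomputable def fC (lam x : ℝ) : ℝ :=
  1 / (lam * Real.pi) * (1 / (1 + (x / lam) ^ 2))

/-- CDF of the zero-mean Cauchy distribution `C(0, lam)`. -/
noncomputable def FC (lam x : ℝ) : ℝ :=
  1 / 2 + 1 / Real.pi * Real.arctan (x / lam)

/-- PDF of the zero-mean Gaussian distribution with standard deviation `sig`. -/
noncomputable def fG (sig x : ℝ) : ℝ :=
  gaussianPDFReal 0 ⟨sig ^ 2, sq_nonneg sig⟩ x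

/-- CDF of the zero-mean Gaussian distribution with standard deviation `sig`. -/
noncomputable def FG (sig x : ℝ) : ℝ :=
  cdf (gaussianReal 0 ⟨sig ^ 2, sq_nonneg sig⟩) x

/-- `μ` is symmetric unimodal (s.u.) about `0`: it has a density which is even and
nonincreasing on `(0, ∞)`. The density may be unbounded near `0`. -/
def IsSymmUnimodal (μ : Measure ℝ) : Prop :=
  ∃ f : ℝ → ℝ, Measurable f ∧ (∀ x, 0 ≤ f x) ∧ (∀ x, f (-x) = f x) ∧
    AntitoneOn f (Set.Ioi 0) ∧ μ = volume.withDensity (fun x => ENNReal.ofReal (f x))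

/-- `F` is the CDF of a symmetric unimodal probability distribution. -/
def IsSymmUnimodalCDF (F : ℝ → ℝ) : Prop :=
  ∃ ν : Measure ℝ, IsProbabilityMeasure ν ∧ IsSymmUnimodal ν ∧ ∀ x, cdf ν x = F x

/-- The CDF `Fob` overbounds the CDF `Fe`. -/
def Overbounds (Fob Fe : ℝ → ℝ) : Prop :=
  (∀ x, Fe x ≤ 1 / 2 → Fe x ≤ Fob x) ∧ (∀ x, 1 / 2 < Fe x → Fob x ≤ Fe x)

/-- `sig` is the minimum scale of a zero-mean Gaussian overbound of the error CDF `Fe`. -/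
def IsOptimalGaussianScale (Fe : ℝ → ℝ) (sig : ℝ) : Prop :=
  IsLeast {s : ℝ | 0 < s ∧ (∀ x ≤ 0, Fe x ≤ FG s x) ∧ (∀ x > 0, FG s x ≤ Fe x)} sig

/-- `lam` is the minimum scale of a zero-mean Cauchy overbound of the error CDF `Fe`, among
scales at most `√(2/π) * sig`, where `sig` is the optimal Gaussian scale. -/
def IsOptimalCauchyScale (Fe : ℝ → ℝ) (sig lam : ℝ) : Prop :=
  IsLeast {l : ℝ | 0 < l ∧ (∀ x ≤ 0, Fe x ≤ FC l x) ∧ (∀ x > 0, FC l x ≤ Fe x) ∧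
    l ≤ Real.sqrt (2 / Real.pi) * sig} lam

/-- `x₁ < x₂` are the abscissae of the points at which a common tangent line touches the Cauchy
CDF (at `x₁`) and the Gaussian CDF (at `x₂`) on the right half-line. -/
def IsTangentPair (lam sig x₁ x₂ : ℝ) : Prop :=
  0 < x₁ ∧ x₁ < x₂ ∧ fC lam x₁ = fG sig x₂ ∧
    fG sig x₂ = (FG sig x₂ - FC lam x₁) / (x₂ - x₁)

/-- The line carrying the right tangential segment, used on `[x₁, x₂]` only. -/
noncomputable def TR (lam x₁ x : ℝ) : ℝ :=
  fC lam x₁ * (x - x₁) + FC lam x₁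

/-- The line carrying the left tangential segment, used on `[-x₂, -x₁]` only. -/
noncomputable def TL (lam x₁ x : ℝ) : ℝ :=
  fC lam x₁ * (x + x₁) + FC lam (-x₁)

/-- The Cauchy-Gaussian overbound: on `x ≤ 0` the minimum, on `x > 0` the maximum, of the Cauchy
CDF, the Gaussian CDF and, on its interval of definition, the tangential segment. -/
noncomputable def Fob (lam sig x₁ x₂ x : ℝ) : ℝ :=
  if x ≤ 0 then
    if -x₂ ≤ x ∧ x ≤ -x₁ then min (FC lam x) (min (TL lam x₁ x) (FG sig x))
    else min (FC lam x) (FG sig x)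
  else
    if x₁ ≤ x ∧ x ≤ x₂ then max (FC lam x) (max (TR lam x₁ x) (FG sig x))
    else max (FC lam x) (FG sig x)

/-- Convolution of finitely many measures on the line. -/
noncomputable def convN : (N : ℕ) → (Fin N → Measure ℝ) → Measure ℝ
  | 0, _ => Measure.dirac 0
  | n + 1, ν => (ν 0).conv (convN n (fun i => ν i.succ))

/-- Projection of range-domain distributions to the position domain with coefficients `S`: the
convolution of the distributions rescaled by `|S i|`. If all `S i ≠ 0` and `ν i` has density
`f i`, its density is the convolution of the functions `x ↦ |S i|⁻¹ * f i (x / |S i|)`. -/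
noncomputable def projected {N : ℕ} (S : Fin N → ℝ) (ν : Fin N → Measure ℝ) : Measure ℝ :=
  convN N (fun i => (ν i).map (fun x => |S i| * x))

end CauchyGaussian

namespace CauchyGaussian

open MeasureTheory ProbabilityTheory Set Filter
open scoped ENNReal Topology

/-! On the right half-line the Cauchy, Gaussian and error CDFs are all concave. A common tangent of
the first two lies above both, and its ends lie on graphs that the error CDF dominates; by concavity
the error CDF dominates the whole segment (`IsSymmUnimodal.line_le_cdf`,
`IsTangentPair.Fob_le_cdf`). Reflection handles the left half-line.

Existence of the tangent rests on one convexity fact: in the variable `t = x ^ 2` the reciprocal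
densities are an exponential and an affine function, so the densities agree at most twice for `x >
0` (`recipGap_neg_of_mem_Ioo`). Hence the Cauchy CDF crosses the Gaussian one at most once, from
above to below (`FC_lt_FG_of_le`), and an intermediate value argument between the maximum and the
minimum of their difference gives the tangent (`exists_tangentPair`).

For the projection, overbounding becomes an order of peakedness: less mass in every interval `[-t,
t]`. As in Birnbaum's theorem, convolution preserves this order for symmetric unimodal laws.
Unimodality is carried as `CenteredDecreasing`, a condition on interval masses that is stable under
convolution and holds for the Dirac mass at `0`, so vanishing coefficients `S i` are covered. -/

/-! ### Peakedness and centred sets -/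

/-- A set of reals closed under passing to numbers of smaller absolute value. -/
def IsCentered (A : Set ℝ) : Prop := ∀ a ∈ A, ∀ b, |b| ≤ |a| → b ∈ A

/-- `μ` is at least as peaked about `0` as `μ'`. -/
def PeakedLE (μ' μ : Measure ℝ) : Prop := ∀ t, μ' (Icc (-t) t) ≤ μ (Icc (-t) t)

/-- The mass of an interval of fixed length decreases as its midpoint moves away from `0`. -/
def CenteredDecreasing (μ : Measure ℝ) : Prop :=
  ∀ t x x', |x| ≤ |x'| → μ (Icc (x' - t) (x' + t)) ≤ μ (Icc (x - t) (x + t))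

theorem IsCentered.measurableSet {A : Set ℝ} (hA : IsCentered A) : MeasurableSet A := by
  refine Set.OrdConnected.measurableSet ⟨fun x hx y hy z hz => ?_⟩
  rcases le_total 0 z with h | h
  · exact hA y hy z (abs_le_abs_of_nonneg h hz.2)
  · exact hA x hx z (abs_le_abs_of_nonpos h hz.1)

/-- By inner regularity it is enough to treat compact subsets of `A`; the symmetric interval
reaching to a point of largest modulus of such a set still lies in `A`. -/
theorem PeakedLE.measure_le {μ' μ : Measure ℝ} [IsFiniteMeasure μ'] (h : PeakedLE μ' μ)
    {A : Set ℝ} (hA : IsCentered A) : μ' A ≤ μ A := by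
  rw [hA.measurableSet.measure_eq_iSup_isCompact]
  refine iSup₂_le fun K hKA => iSup_le fun hK => ?_
  rcases K.eq_empty_or_nonempty with rfl | hne
  · simp
  obtain ⟨a, haK, ha⟩ := hK.exists_isMaxOn hne (f := fun x : ℝ => |x|) (by fun_prop)
  calc μ' K ≤ μ' (Icc (-|a|) |a|) := measure_mono fun x hx => abs_le.1 (ha hx)
    _ ≤ μ (Icc (-|a|) |a|) := h _
    _ ≤ μ A := measure_mono fun x hx => hA a (hKA haK) x (abs_le.2 hx)

/-- Layer-cake formula. -/
theorem lintegral_mono_of_superlevel {μ' μ : Measure ℝ} {g : ℝ → ℝ} (hg : Measurable g)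
    (h0 : ∀ x, 0 ≤ g x) (h : ∀ s, μ' {x | s < g x} ≤ μ {x | s < g x}) :
    ∫⁻ x, ENNReal.ofReal (g x) ∂μ' ≤ ∫⁻ x, ENNReal.ofReal (g x) ∂μ := by
  rw [lintegral_eq_lintegral_meas_lt μ' (.of_forall h0) hg.aemeasurable,
    lintegral_eq_lintegral_meas_lt μ (.of_forall h0) hg.aemeasurable]
  exact lintegral_mono fun s => h s

theorem isCentered_superlevel {g : ℝ → ℝ} (hg : ∀ x y, |x| ≤ |y| → g y ≤ g x) (s : ℝ) :
    IsCentered {x | s < g x} :=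
  fun a ha b hb => lt_of_lt_of_le ha (hg b a hb)

theorem measurable_of_abs_antitone {g : ℝ → ℝ} (hg : ∀ x y, |x| ≤ |y| → g y ≤ g x) :
    Measurable g :=
  measurable_of_Ioi fun s => (isCentered_superlevel hg s).measurableSet

theorem PeakedLE.lintegral_le {μ' μ : Measure ℝ} [IsFiniteMeasure μ'] (h : PeakedLE μ' μ)
    {g : ℝ → ℝ} (h0 : ∀ x, 0 ≤ g x) (hg : ∀ x y, |x| ≤ |y| → g y ≤ g x) :
    ∫⁻ x, ENNReal.ofReal (g x) ∂μ' ≤ ∫⁻ x, ENNReal.ofReal (g x) ∂μ :=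
  lintegral_mono_of_superlevel (measurable_of_abs_antitone hg) h0
    fun s => h.measure_le (isCentered_superlevel hg s)

theorem CenteredDecreasing.real_le {ν : Measure ℝ} [IsFiniteMeasure ν]
    (hν : CenteredDecreasing ν) (t x y : ℝ) (hxy : |x| ≤ |y|) :
    ν.real (Icc (y - t) (y + t)) ≤ ν.real (Icc (x - t) (x + t)) :=
  ENNReal.toReal_mono (measure_ne_top _ _) (hν t x y hxy)

/-! ### Convolution, scaling and sums -/

/-- The integrand depends only on `ν` and `t` and decreases in `|y|`, while `x` and `μ` enter only
through the measure. Comparing two convolutions thus reduces to comparing the peakedness of two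
reflected translates. -/
theorem conv_Icc_eq {μ ν : Measure ℝ} [IsFiniteMeasure μ] [IsFiniteMeasure ν]
    (hν : CenteredDecreasing ν) (x t : ℝ) :
    (μ.conv ν) (Icc (x - t) (x + t)) =
      ∫⁻ y, ENNReal.ofReal (ν.real (Icc (y - t) (y + t))) ∂(μ.map fun y => x - y) := by
  have hm := measurable_of_abs_antitone (hν.real_le t)
  rw [lintegral_map hm.ennreal_ofReal (by fun_prop), ← lintegral_indicator_one measurableSet_Icc,
    Measure.lintegral_conv (measurable_one.indicator measurableSet_Icc)]
  refine lintegral_congr fun y => ?_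
  rw [measureReal_def, ENNReal.ofReal_toReal (measure_ne_top _ _),
    ← lintegral_indicator_one measurableSet_Icc]
  refine lintegral_congr fun z => ?_
  have : y + z ∈ Icc (x - t) (x + t) ↔ z ∈ Icc (x - y - t) (x - y + t) := by
    simp only [mem_Icc]; constructor <;> rintro ⟨h1, h2⟩ <;> constructor <;> linarith
  by_cases h : y + z ∈ Icc (x - t) (x + t)
  · rw [indicator_of_mem h, indicator_of_mem (this.1 h)]; rfl
  · rw [indicator_of_notMem h, indicator_of_notMem fun h' => h (this.2 h')]

theorem map_const_sub_Icc (μ : Measure ℝ) (x s : ℝ) :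
    (μ.map fun y => x - y) (Icc (-s) s) = μ (Icc (x - s) (x + s)) := by
  rw [Measure.map_apply (by fun_prop) measurableSet_Icc]
  congr 1
  ext y
  simp only [mem_preimage, mem_Icc]
  constructor <;> rintro ⟨h1, h2⟩ <;> constructor <;> linarith

theorem CenteredDecreasing.conv {μ ν : Measure ℝ} [IsFiniteMeasure μ] [IsFiniteMeasure ν]
    (hμ : CenteredDecreasing μ) (hν : CenteredDecreasing ν) :
    CenteredDecreasing (μ.conv ν) := by
  intro t x x' hx
  rw [conv_Icc_eq hν, conv_Icc_eq hν]
  refine PeakedLE.lintegral_le (fun s => ?_) (fun _ => measureReal_nonneg) (hν.real_le t)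
  rw [map_const_sub_Icc, map_const_sub_Icc]
  exact hμ s x x' hx

theorem PeakedLE.conv_right {μ' μ ν : Measure ℝ} [IsFiniteMeasure μ] [IsFiniteMeasure μ']
    [IsFiniteMeasure ν] (h : PeakedLE μ' μ) (hν : CenteredDecreasing ν) :
    PeakedLE (μ'.conv ν) (μ.conv ν) := by
  intro t
  have e (ρ : Measure ℝ) [IsFiniteMeasure ρ] := conv_Icc_eq (μ := ρ) hν 0 t
  simp only [zero_sub, zero_add] at e
  rw [e, e]
  refine PeakedLE.lintegral_le (fun s => ?_) (fun _ => measureReal_nonneg) (hν.real_le t)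
  have m (ρ : Measure ℝ) := map_const_sub_Icc ρ 0 s
  simp only [zero_sub, zero_add] at m
  rw [m, m]
  exact h s

/-- The factors are exchanged one at a time through `μ.conv ν'`, which is why unimodality is asked
of `μ` and `ν'`. -/
theorem PeakedLE.conv {μ' μ ν' ν : Measure ℝ} [IsFiniteMeasure μ] [IsFiniteMeasure μ']
    [IsFiniteMeasure ν] [IsFiniteMeasure ν'] (h : PeakedLE μ' μ) (h' : PeakedLE ν' ν)
    (hμ : CenteredDecreasing μ) (hν : CenteredDecreasing ν') :
    PeakedLE (μ'.conv ν') (μ.conv ν) := by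
  intro t
  refine (h.conv_right hν t).trans ?_
  rw [Measure.conv_comm μ ν', Measure.conv_comm μ ν]
  exact h'.conv_right hμ t

theorem centeredDecreasing_dirac : CenteredDecreasing (Measure.dirac 0) := by
  intro t x x' hx
  rw [Measure.dirac_apply' _ measurableSet_Icc, Measure.dirac_apply' _ measurableSet_Icc]
  by_cases h : (0 : ℝ) ∈ Icc (x' - t) (x' + t)
  · have h1 : |x| ≤ t := hx.trans (abs_le.2 ⟨by linarith [h.2], by linarith [h.1]⟩)
    have h2 := abs_le.1 h1
    rw [indicator_of_mem h, indicator_of_mem (by constructor <;> linarith)]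
  · rw [indicator_of_notMem h]
    exact zero_le

theorem CenteredDecreasing.map_mul {μ : Measure ℝ} [IsProbabilityMeasure μ]
    (hμ : CenteredDecreasing μ) (S : ℝ) : CenteredDecreasing (μ.map fun x => S * x) := by
  rcases eq_or_ne S 0 with rfl | hS
  · simpa using centeredDecreasing_dirac
  intro t x x' hx
  have e (x : ℝ) : (fun y => S * y) ⁻¹' Icc (x - t) (x + t) =
      Icc (x / S - t / |S|) (x / S + t / |S|) := by
    ext y
    have h1 : y ∈ (fun y => S * y) ⁻¹' Icc (x - t) (x + t) ↔ |S * y - x| ≤ t := by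
      rw [abs_le, mem_preimage, mem_Icc]
      constructor <;> rintro ⟨h1, h2⟩ <;> constructor <;> linarith
    have h2 : y ∈ Icc (x / S - t / |S|) (x / S + t / |S|) ↔ |y - x / S| ≤ t / |S| := by
      rw [abs_le, mem_Icc]
      constructor <;> rintro ⟨h1, h2⟩ <;> constructor <;> linarith
    have h3 : S * y - x = S * (y - x / S) := by field_simp
    rw [h1, h2, h3, abs_mul, le_div_iff₀' (abs_pos.2 hS)]
  rw [Measure.map_apply (by fun_prop) measurableSet_Icc,
    Measure.map_apply (by fun_prop) measurableSet_Icc, e, e]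
  apply hμ
  rw [abs_div, abs_div]
  gcongr

/-- A symmetric interval has the same preimage under both scalings. That preimage is centred, also
when `S = 0` and it is empty or the whole line. -/
theorem PeakedLE.map_mul {μ' μ : Measure ℝ} [IsFiniteMeasure μ'] (h : PeakedLE μ' μ) (S : ℝ) :
    PeakedLE (μ'.map fun x => |S| * x) (μ.map fun x => S * x) := by
  intro t
  have e : (fun x => |S| * x) ⁻¹' Icc (-t) t = (fun x => S * x) ⁻¹' Icc (-t) t := by
    ext x
    simp only [mem_preimage, mem_Icc, ← abs_le, abs_mul, abs_abs]
  rw [Measure.map_apply (by fun_prop) measurableSet_Icc,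
    Measure.map_apply (by fun_prop) measurableSet_Icc, e]
  refine h.measure_le fun a ha b hb => ?_
  simp only [mem_preimage, mem_Icc, ← abs_le, abs_mul] at ha ⊢
  exact le_trans (by gcongr) ha

instance isProbabilityMeasure_convN : ∀ (N : ℕ) (ν : Fin N → Measure ℝ)
    [∀ i, IsProbabilityMeasure (ν i)], IsProbabilityMeasure (convN N ν)
  | 0, _, _ => by unfold convN; infer_instance
  | n + 1, ν, _ => by
    have := isProbabilityMeasure_convN n (fun i => ν i.succ)
    unfold convN; infer_instance

theorem centeredDecreasing_convN : ∀ (N : ℕ) (ν : Fin N → Measure ℝ)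
    [∀ i, IsProbabilityMeasure (ν i)], (∀ i, CenteredDecreasing (ν i)) →
    CenteredDecreasing (convN N ν)
  | 0, _, _, _ => centeredDecreasing_dirac
  | n + 1, _, _, h => (h 0).conv (centeredDecreasing_convN n _ fun i => h i.succ)

theorem peakedLE_convN : ∀ (N : ℕ) (ν' ν : Fin N → Measure ℝ)
    [∀ i, IsProbabilityMeasure (ν' i)] [∀ i, IsProbabilityMeasure (ν i)],
    (∀ i, CenteredDecreasing (ν' i)) → (∀ i, CenteredDecreasing (ν i)) →
    (∀ i, PeakedLE (ν' i) (ν i)) → PeakedLE (convN N ν') (convN N ν)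
  | 0, _, _, _, _, _, _, _ => fun _ => le_rfl
  | n + 1, _, _, _, _, h', h, hp =>
    (hp 0).conv (peakedLE_convN n _ _ (fun i => h' i.succ) (fun i => h i.succ)
      fun i => hp i.succ) (h 0) (centeredDecreasing_convN n _ fun i => h' i.succ)

theorem map_sum_eq_convN {Ω : Type*} [MeasurableSpace Ω] (P : Measure Ω)
    [IsProbabilityMeasure P] : ∀ (N : ℕ) (X : Fin N → Ω → ℝ), (∀ i, Measurable (X i)) →
    iIndepFun X P → P.map (fun ω => ∑ i, X i ω) = convN N fun i => P.map (X i)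
  | 0, X, _, _ => by simp [convN]
  | n + 1, X, hX, hi => by
    have ih := map_sum_eq_convN P n (fun i => X i.succ) (fun i => hX _)
      (hi.precomp (Fin.succ_injective n))
    have hind : IndepFun (X 0) (fun ω => ∑ i : Fin n, X i.succ ω) P := by
      have := (hi.indepFun_finsetSum_of_notMem hX
        (s := Finset.univ.map (Fin.succEmb n)) (i := 0) (by simp)).symm
      convert this using 1
      ext ω
      simp
    rw [convN, ← ih, ← hind.map_add_eq_map_conv_map (hX 0) (by fun_prop)]
    congr 1
    ext ω
    simp [Fin.sum_univ_succ]

/-! ### From peakedness to CDFs -/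

/-- The reflection of `μ` has the same half-line masses. -/
theorem CenteredDecreasing.measure_Ici {μ : Measure ℝ} [IsFiniteMeasure μ]
    (hμ : CenteredDecreasing μ) (x : ℝ) : μ (Ici (-x)) = μ (Iic x) := by
  have e1 : Ici (-x) = ⋃ n : ℕ, Icc (-x) (-x + 2 * n) := by
    ext y
    simp only [mem_Ici, mem_iUnion, mem_Icc]
    refine ⟨fun h => ?_, fun ⟨n, h⟩ => h.1⟩
    obtain ⟨n, hn⟩ := exists_nat_ge (y + x)
    exact ⟨n, h, by linarith [n.cast_nonneg (α := ℝ)]⟩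
  have e2 : Iic x = ⋃ n : ℕ, Icc (x - 2 * n) x := by
    ext y
    simp only [mem_Iic, mem_iUnion, mem_Icc]
    refine ⟨fun h => ?_, fun ⟨n, h⟩ => h.2⟩
    obtain ⟨n, hn⟩ := exists_nat_ge (x - y)
    exact ⟨n, by linarith [n.cast_nonneg (α := ℝ)], h⟩
  have m1 : Monotone fun n : ℕ => Icc (-x) (-x + 2 * (n : ℝ)) := fun a b hab =>
    Icc_subset_Icc_right (by gcongr)
  have m2 : Monotone fun n : ℕ => Icc (x - 2 * (n : ℝ)) x := fun a b hab =>
    Icc_subset_Icc_left (by gcongr)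
  rw [e1, e2, m1.measure_iUnion, m2.measure_iUnion]
  refine iSup_congr fun n => ?_
  -- The two windows of half-length `n` have opposite centres, so monotonicity applies in both
  -- directions.
  have h1 := hμ n (x - n) (-x + n) (by rw [← abs_neg]; ring_nf; rfl)
  have h2 := hμ n (-x + n) (x - n) (by rw [← abs_neg]; ring_nf; rfl)
  have := le_antisymm h1 h2
  convert this using 3 <;> ring

/-- The half-lines `Iic x` and `Ici (-x)` have equal mass. For `0 ≤ x` they cover the line and
overlap in a closed interval; for `x < 0` they are disjoint and miss an open one. The distinction
matters because an atom at `0` is allowed. -/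
theorem CenteredDecreasing.cdf_add_of_nonneg {μ : Measure ℝ} [IsProbabilityMeasure μ]
    (hμ : CenteredDecreasing μ) {x : ℝ} (hx : 0 ≤ x) :
    2 * cdf μ x = 1 + μ.real (Icc (-x) x) := by
  have h1 := measureReal_union_add_inter (μ := μ) (s := Iic x) (t := Ici (-x)) measurableSet_Ici
  have h2 : Iic x ∪ Ici (-x) = univ := by
    ext y; simp only [mem_union, mem_Iic, mem_Ici, mem_univ, iff_true]
    by_contra h; push Not at h; linarith
  have h3 : Iic x ∩ Ici (-x) = Icc (-x) x := by rw [inter_comm, Ici_inter_Iic]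
  have h4 : μ.real (Ici (-x)) = μ.real (Iic x) := by simp [measureReal_def, hμ.measure_Ici x]
  rw [h2, h3, h4, probReal_univ] at h1
  rw [cdf_eq_real]; linarith

theorem CenteredDecreasing.cdf_add_of_neg {μ : Measure ℝ} [IsProbabilityMeasure μ]
    (hμ : CenteredDecreasing μ) {x : ℝ} (hx : x < 0) :
    2 * cdf μ x = 1 - μ.real (Ioo x (-x)) := by
  have h1 := measureReal_union_add_inter (μ := μ) (s := Iic x) (t := Ici (-x)) measurableSet_Ici
  have h3 : Iic x ∩ Ici (-x) = ∅ := by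
    ext y; simp only [mem_inter_iff, mem_Iic, mem_Ici, mem_empty_iff_false, iff_false]
    rintro ⟨h, h'⟩; linarith
  have h4 : μ.real (Ici (-x)) = μ.real (Iic x) := by simp [measureReal_def, hμ.measure_Ici x]
  have h2 : (Iic x ∪ Ici (-x))ᶜ = Ioo x (-x) := by
    ext y; simp [mem_Ioo]
  have h5 := probReal_compl_eq_one_sub (μ := μ) (s := Iic x ∪ Ici (-x))
    (measurableSet_Iic.union measurableSet_Ici)
  rw [h3, h4, measureReal_empty] at h1
  rw [h2] at h5
  rw [cdf_eq_real]; linarith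

theorem PeakedLE.overbounds {ν μ : Measure ℝ} [IsProbabilityMeasure ν] [IsProbabilityMeasure μ]
    (h : PeakedLE ν μ) (hν : CenteredDecreasing ν) (hμ : CenteredDecreasing μ) :
    Overbounds (cdf ν) (cdf μ) := by
  have r {A : Set ℝ} (hA : IsCentered A) : ν.real A ≤ μ.real A :=
    ENNReal.toReal_mono (measure_ne_top _ _) (h.measure_le hA)
  constructor <;> intro x hx <;> rcases lt_or_ge x 0 with hx0 | hx0
  · have := r (A := Ioo x (-x)) fun a ha b hb => by
      have : |a| < -x := abs_lt.2 ⟨by linarith [ha.1], ha.2⟩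
      have := abs_lt.1 (hb.trans_lt this)
      exact ⟨by linarith, this.2⟩
    linarith [hν.cdf_add_of_neg hx0, hμ.cdf_add_of_neg hx0]
  -- In the two mixed cases the sign of `x` alone places one CDF on the required side of `1 / 2`.
  · linarith [hν.cdf_add_of_nonneg hx0, measureReal_nonneg (μ := ν) (s := Icc (-x) x)]
  · linarith [hμ.cdf_add_of_neg hx0, measureReal_nonneg (μ := μ) (s := Ioo x (-x))]
  · have := r (A := Icc (-x) x) fun a ha b hb => abs_le.1 (hb.trans (abs_le.2 ha))
    linarith [hν.cdf_add_of_nonneg hx0, hμ.cdf_add_of_nonneg hx0]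

/-! ### Symmetric unimodal laws and concavity of their CDFs -/

/-- A symmetric unimodal density gives masses that decrease away from the centre. -/
theorem IsSymmUnimodal.centeredDecreasing {μ : Measure ℝ} (h : IsSymmUnimodal μ) :
    CenteredDecreasing μ := by
  obtain ⟨f, hf, h0, hev, hanti, rfl⟩ := h
  intro t x x' hx
  rw [withDensity_apply _ measurableSet_Icc, withDensity_apply _ measurableSet_Icc]
  -- For Lebesgue measure: the overlap of a window with `[-s, s]` shrinks as the window moves away
  -- from `0`.
  have hp : PeakedLE (volume.restrict (Icc (x' - t) (x' + t)))
      (volume.restrict (Icc (x - t) (x + t))) := by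
    intro s
    rw [Measure.restrict_apply measurableSet_Icc, Measure.restrict_apply measurableSet_Icc,
      Icc_inter_Icc, Icc_inter_Icc, Real.volume_Icc, Real.volume_Icc]
    rcases lt_or_ge s 0 with hs | hs
    · rw [ENNReal.ofReal_of_nonpos]
      · exact zero_le
      · have := min_le_left s (x' + t)
        have := le_max_left (-s) (x' - t)
        linarith
    apply ENNReal.ofReal_le_ofReal
    rcases abs_cases x with ⟨h1, h1'⟩ | ⟨h1, h1'⟩ <;>
    rcases abs_cases x' with ⟨h2, h2'⟩ | ⟨h2, h2'⟩ <;>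
    rcases min_cases s (x' + t) with ⟨h3, h3'⟩ | ⟨h3, h3'⟩ <;>
    rcases min_cases s (x + t) with ⟨h4, h4'⟩ | ⟨h4, h4'⟩ <;>
    rcases max_cases (-s) (x' - t) with ⟨h5, h5'⟩ | ⟨h5, h5'⟩ <;>
    rcases max_cases (-s) (x - t) with ⟨h6, h6'⟩ | ⟨h6, h6'⟩ <;>
    rw [h3, h4, h5, h6] <;>
    linarith
  refine lintegral_mono_of_superlevel hf h0 fun s => ?_
  have habs (a : ℝ) : f |a| = f a := by rcases abs_choice a with h | h <;> rw [h]; exact hev a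
  -- The value `f 0` is unconstrained, so a superlevel set may lack the origin; adding this null
  -- point makes it centred.
  have hc : IsCentered ({y | s < f y} ∪ {0}) := by
    rintro a ha b hb
    rcases eq_or_ne b 0 with rfl | hb0
    · right; rfl
    have hb' : 0 < |b| := abs_pos.2 hb0
    rcases ha with ha | rfl
    · left
      change s < f b
      rw [← habs b]
      refine lt_of_lt_of_le ?_ (hanti (mem_Ioi.2 hb') (mem_Ioi.2 (hb'.trans_le hb)) hb)
      rw [habs]; exact ha
    · simp at hb; exact absurd hb hb0
  calc _ ≤ _ := measure_mono subset_union_left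
    _ ≤ _ := hp.measure_le hc
    _ ≤ _ := measure_union_le _ _
    _ = _ := by simp

theorem measure_Ioc_eq_cdf_sub (μ : Measure ℝ) [IsProbabilityMeasure μ] (a b : ℝ) :
    μ (Ioc a b) = ENNReal.ofReal (cdf μ b - cdf μ a) := by
  conv_lhs => rw [← measure_cdf μ]
  exact StieltjesFunction.measure_Ioc _ _ _

theorem IsSymmUnimodal.nullSingletonClass {μ : Measure ℝ} (h : IsSymmUnimodal μ) : NullSingletonClass μ := by
  obtain ⟨f, hf, -, -, -, rfl⟩ := h
  exact ⟨fun x => withDensity_absolutelyContinuous _ _ (measure_singleton x)⟩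

theorem IsSymmUnimodal.cdf_neg {μ : Measure ℝ} [IsProbabilityMeasure μ] (h : IsSymmUnimodal μ)
    (x : ℝ) : cdf μ (-x) = 1 - cdf μ x := by
  have := h.nullSingletonClass
  have h1 := h.centeredDecreasing.measure_Ici x
  have h3 := probReal_compl_eq_one_sub (μ := μ) (measurableSet_Iic (a := -x))
  rw [compl_Iic, measureReal_congr Ioi_ae_eq_Ici, measureReal_def, h1, ← measureReal_def] at h3
  rw [cdf_eq_real, cdf_eq_real]; linarith

theorem IsSymmUnimodal.measure_Icc {μ : Measure ℝ} [IsProbabilityMeasure μ]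
    (h : IsSymmUnimodal μ) (t : ℝ) :
    μ (Icc (-t) t) = ENNReal.ofReal (2 * cdf μ t - 1) := by
  have := h.nullSingletonClass
  rw [← measure_congr Ioc_ae_eq_Icc, measure_Ioc_eq_cdf_sub, h.cdf_neg]
  ring_nf

/-- The density value is a supergradient of the CDF on the right half-line. -/
theorem cdf_le_of_antitoneOn {μ : Measure ℝ} [IsProbabilityMeasure μ] {f : ℝ → ℝ}
    (h0 : ∀ x, 0 ≤ f x) (hf : AntitoneOn f (Ioi 0))
    (hμ : μ = volume.withDensity fun x => ENNReal.ofReal (f x)) {b y : ℝ} (hb : 0 < b)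
    (hy : 0 ≤ y) : cdf μ y ≤ cdf μ b + f b * (y - b) := by
  rcases le_total b y with h | h
  · have h1 : μ (Ioc b y) ≤ ENNReal.ofReal (f b * (y - b)) := by
      rw [hμ, withDensity_apply _ measurableSet_Ioc]
      calc _ ≤ ∫⁻ _ in Ioc b y, ENNReal.ofReal (f b) :=
            setLIntegral_mono measurable_const fun x hx => ENNReal.ofReal_le_ofReal
              (hf hb (hb.trans hx.1) hx.1.le)
        _ = _ := by rw [setLIntegral_const, Real.volume_Ioc, ENNReal.ofReal_mul (h0 b)]
    rw [measure_Ioc_eq_cdf_sub,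
      ENNReal.ofReal_le_ofReal_iff (mul_nonneg (h0 b) (by linarith))] at h1
    linarith
  · have h1 : ENNReal.ofReal (f b * (b - y)) ≤ μ (Ioc y b) := by
      rw [hμ, withDensity_apply _ measurableSet_Ioc]
      calc _ = ∫⁻ _ in Ioc y b, ENNReal.ofReal (f b) := by
            rw [setLIntegral_const, Real.volume_Ioc, ENNReal.ofReal_mul (h0 b)]
        _ ≤ _ := setLIntegral_mono' measurableSet_Ioc fun x hx => ENNReal.ofReal_le_ofReal
              (hf (mem_Ioi.2 (hy.trans_lt hx.1)) hb hx.2)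
    rw [measure_Ioc_eq_cdf_sub,
      ENNReal.ofReal_le_ofReal_iff (by linarith [monotone_cdf μ h])] at h1
    linarith

/-- On the right half-line the CDF of a symmetric unimodal distribution lies above every line
that it dominates at two points, between these points. -/
theorem IsSymmUnimodal.line_le_cdf {μ : Measure ℝ} [IsProbabilityMeasure μ]
    (h : IsSymmUnimodal μ) {k c a b x : ℝ} (ha : 0 < a) (hax : a ≤ x) (hxb : x ≤ b)
    (h1 : k * a + c ≤ cdf μ a) (h2 : k * b + c ≤ cdf μ b) : k * x + c ≤ cdf μ x := by
  obtain ⟨f, -, h0, -, hanti, hμ⟩ := h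
  have hx : 0 < x := ha.trans_le hax
  have g1 := cdf_le_of_antitoneOn h0 hanti hμ hx ha.le
  have g2 := cdf_le_of_antitoneOn h0 hanti hμ hx (hx.le.trans hxb)
  -- The supergradient `f x` is compared at the left endpoint if it is at least the slope `k`, and
  -- at the right endpoint otherwise.
  rcases le_total k (f x) with hk | hk
  · nlinarith [mul_nonneg (sub_nonneg.2 hk) (sub_nonneg.2 hax)]
  · nlinarith [mul_nonneg (sub_nonneg.2 hk) (sub_nonneg.2 hxb)]

/-! ### Densities as derivatives of CDFs -/

/-- The exceptional set allows a piecewise `F` to be differentiated only away from its junctions;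
continuity of `F` suffices there. -/
theorem withDensity_cdf_of_hasDerivAt {F f : ℝ → ℝ} {s : Set ℝ} (hs : s.Countable)
    (hF : Continuous F) (hf : Continuous f) (h0 : ∀ x, 0 ≤ f x)
    (hd : ∀ x ∉ s, HasDerivAt F (f x) x)
    (hbot : Tendsto F atBot (𝓝 0)) (htop : Tendsto F atTop (𝓝 1)) :
    IsProbabilityMeasure (volume.withDensity fun x => ENNReal.ofReal (f x)) ∧
      ∀ x, cdf (volume.withDensity fun x => ENNReal.ofReal (f x)) x = F x := by
  have ftc (a b : ℝ) : ∫ x in a..b, f x = F b - F a :=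
    integral_eq_of_hasDerivAt_off_countable F f hs hF.continuousOn (fun x hx => hd x hx.2)
      (hf.intervalIntegrable _ _)
  have hmono : Monotone F := fun a b hab => by
    have := intervalIntegral.integral_nonneg hab (μ := volume) fun x _ => h0 x
    rw [ftc] at this
    linarith
  let G : StieltjesFunction ℝ := ⟨F, hmono, fun x => hF.continuousWithinAt⟩
  have hG : volume.withDensity (fun x => ENNReal.ofReal (f x)) = G.measure := by
    symm
    refine Measure.ext_of_Ioc _ _ fun a b hab => ?_
    rw [StieltjesFunction.measure_Ioc, withDensity_apply _ measurableSet_Ioc,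
      ← ofReal_integral_eq_lintegral_ofReal
        ((hf.integrableOn_Icc (a := a) (b := b)).mono_set Ioc_subset_Icc_self)
        (.of_forall h0), ← intervalIntegral.integral_of_le hab.le, ftc]
  rw [hG, cdf_measure_stieltjesFunction G hbot htop]
  exact ⟨⟨by rw [G.measure_univ hbot htop]; simp⟩, fun x => rfl⟩

theorem hasDerivAt_cdf_withDensity {μ : Measure ℝ} [IsProbabilityMeasure μ] {f : ℝ → ℝ}
    (hf : Continuous f) (h0 : ∀ x, 0 ≤ f x)
    (hμ : μ = volume.withDensity fun x => ENNReal.ofReal (f x)) (x : ℝ) :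
    HasDerivAt (cdf μ) (f x) x := by
  have key (a b : ℝ) (hab : a ≤ b) : cdf μ b - cdf μ a = ∫ x in a..b, f x := by
    have h1 := measure_Ioc_eq_cdf_sub μ a b
    rw [hμ, withDensity_apply _ measurableSet_Ioc, ← hμ,
      ← ofReal_integral_eq_lintegral_ofReal
        ((hf.integrableOn_Icc (a := a) (b := b)).mono_set Ioc_subset_Icc_self)
        (.of_forall h0), ← intervalIntegral.integral_of_le hab,
      ENNReal.ofReal_eq_ofReal_iff (intervalIntegral.integral_nonneg hab fun x _ => h0 x)
        (by linarith [monotone_cdf μ hab])] at h1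
    exact h1.symm
  have e : (cdf μ : ℝ → ℝ) = fun y => cdf μ 0 + ∫ x in (0 : ℝ)..y, f x := by
    ext y
    rcases le_total 0 y with h | h
    · rw [← key 0 y h]; ring
    · rw [intervalIntegral.integral_symm, ← key y 0 h]; ring
  rw [e]
  exact (hf.integral_hasStrictDerivAt 0 x).hasDerivAt.const_add _

/-- A primitive of a strictly decreasing function lies strictly below its tangents. -/
theorem lt_tangent_of_strictAntiOn {F f : ℝ → ℝ} (hd : ∀ x, HasDerivAt F (f x) x)
    (hf : StrictAntiOn f (Ici 0)) {x y : ℝ} (hx : 0 ≤ x) (hy : 0 ≤ y) (hxy : y ≠ x) :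
    F y < F x + f x * (y - x) := by
  have hc : Continuous F := continuous_iff_continuousAt.2 fun x => (hd x).continuousAt
  rcases lt_or_gt_of_ne hxy with h | h
  · obtain ⟨c, hc, e⟩ := exists_hasDerivAt_eq_slope F f h hc.continuousOn fun x _ => hd x
    rw [eq_div_iff (by linarith)] at e
    have := hf (mem_Ici.2 (hy.trans hc.1.le)) (mem_Ici.2 hx) hc.2
    nlinarith
  · obtain ⟨c, hc, e⟩ := exists_hasDerivAt_eq_slope F f h hc.continuousOn fun x _ => hd x
    rw [eq_div_iff (by linarith)] at e
    have := hf (mem_Ici.2 hx) (mem_Ici.2 (hx.trans hc.1.le)) hc.1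
    nlinarith

/-! ### The Cauchy distribution -/

section Cauchy

variable {lam : ℝ}

theorem fC_eq_one_div (x : ℝ) : fC lam x = 1 / (lam * Real.pi * (1 + (x / lam) ^ 2)) := by
  rw [fC, one_div_mul_one_div]

theorem fC_denom_pos (hl : 0 < lam) (x : ℝ) : 0 < lam * Real.pi * (1 + (x / lam) ^ 2) := by
  have := Real.pi_pos
  positivity

theorem fC_pos (hl : 0 < lam) (x : ℝ) : 0 < fC lam x := by
  rw [fC_eq_one_div]; exact one_div_pos.2 (fC_denom_pos hl x)

theorem fC_neg (x : ℝ) : fC lam (-x) = fC lam x := by simp [fC, neg_div]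

theorem fC_strictAntiOn (hl : 0 < lam) : StrictAntiOn (fC lam) (Ici 0) := by
  intro x hx y hy hxy
  rw [fC_eq_one_div, fC_eq_one_div]
  have := Real.pi_pos
  have hx : 0 ≤ x := hx
  refine one_div_lt_one_div_of_lt (fC_denom_pos hl x) ?_
  have : (x / lam) ^ 2 < (y / lam) ^ 2 := by gcongr
  gcongr

theorem continuous_fC (hl : 0 < lam) : Continuous (fC lam) := by
  simp only [funext fC_eq_one_div]
  exact continuous_const.div (by fun_prop) fun x => (fC_denom_pos hl x).ne'

theorem hasDerivAt_FC (hl : 0 < lam) (x : ℝ) : HasDerivAt (FC lam) (fC lam x) x := by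
  have h := (((hasDerivAt_id x).div_const lam).arctan.const_mul (1 / Real.pi)).const_add (1 / 2)
  refine h.congr_deriv ?_
  have := Real.pi_pos
  have h2 : 1 + (x / lam) ^ 2 ≠ 0 := by positivity
  simp only [fC, id]
  field_simp

theorem FC_neg (x : ℝ) : FC lam (-x) = 1 - FC lam x := by
  simp only [FC, neg_div, Real.arctan_neg]; ring

theorem tendsto_FC_atTop (hl : 0 < lam) : Tendsto (FC lam) atTop (𝓝 1) := by
  have h1 : Tendsto (fun x => Real.arctan (x / lam)) atTop (𝓝 (Real.pi / 2)) :=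
    (Real.tendsto_arctan_atTop.mono_right nhdsWithin_le_nhds).comp (tendsto_id.atTop_div_const hl)
  have h2 := (h1.const_mul (1 / Real.pi)).const_add (1 / 2)
  have := Real.pi_pos
  have e : 1 / 2 + 1 / Real.pi * (Real.pi / 2) = 1 := by field_simp; norm_num
  rwa [e] at h2

theorem FC_zero : FC lam 0 = 1 / 2 := by simp [FC]

theorem half_lt_FC (hl : 0 < lam) {x : ℝ} (hx : 0 < x) : 1 / 2 < FC lam x := by
  have h1 : 0 < Real.arctan (x / lam) := Real.arctan_pos.2 (by positivity)
  have := Real.pi_pos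
  have : 0 < 1 / Real.pi * Real.arctan (x / lam) := by positivity
  rw [FC]; linarith

end Cauchy

/-! ### The Gaussian distribution -/

section Gauss

variable {sig : ℝ}

theorem fG_eq_one_div (x : ℝ) :
    fG sig x = 1 / (√(2 * Real.pi * sig ^ 2) * Real.exp (x ^ 2 / (2 * sig ^ 2))) := by
  have h : fG sig x = (√(2 * Real.pi * sig ^ 2))⁻¹ * Real.exp (-(x - 0) ^ 2 / (2 * sig ^ 2)) :=
    rfl
  rw [h, one_div, mul_inv, ← Real.exp_neg, sub_zero, neg_div]

theorem fG_denom_pos (hs : 0 < sig) (x : ℝ) :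
    0 < √(2 * Real.pi * sig ^ 2) * Real.exp (x ^ 2 / (2 * sig ^ 2)) := by
  have := Real.pi_pos
  positivity

theorem fG_pos (hs : 0 < sig) (x : ℝ) : 0 < fG sig x := by
  rw [fG_eq_one_div]; exact one_div_pos.2 (fG_denom_pos hs x)

theorem fG_neg (x : ℝ) : fG sig (-x) = fG sig x := by simp [fG_eq_one_div]

theorem fG_strictAntiOn (hs : 0 < sig) : StrictAntiOn (fG sig) (Ici 0) := by
  intro x hx y hy hxy
  rw [fG_eq_one_div, fG_eq_one_div]
  have := Real.pi_pos
  have hx : 0 ≤ x := hx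
  refine one_div_lt_one_div_of_lt (fG_denom_pos hs x) ?_
  gcongr

theorem continuous_fG (hs : 0 < sig) : Continuous (fG sig) := by
  simp only [funext fG_eq_one_div]
  exact continuous_const.div (by fun_prop) fun x => (fG_denom_pos hs x).ne'

instance isProbabilityMeasure_gaussianReal_sq :
    IsProbabilityMeasure (gaussianReal 0 ⟨sig ^ 2, sq_nonneg sig⟩) :=
  instIsProbabilityMeasureGaussianReal 0 _

theorem gaussianReal_eq_withDensity_fG (hs : 0 < sig) :
    gaussianReal 0 ⟨sig ^ 2, sq_nonneg sig⟩ =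
      volume.withDensity fun x => ENNReal.ofReal (fG sig x) := by
  have hv : (⟨sig ^ 2, sq_nonneg sig⟩ : NNReal) ≠ 0 := by
    intro h
    have := congrArg NNReal.toReal h
    exact (pow_pos hs 2).ne' this
  rw [gaussianReal_of_var_ne_zero _ hv]
  rfl

theorem hasDerivAt_FG (hs : 0 < sig) (x : ℝ) : HasDerivAt (FG sig) (fG sig x) x :=
  hasDerivAt_cdf_withDensity (continuous_fG hs) (fun x => (fG_pos hs x).le)
    (gaussianReal_eq_withDensity_fG hs) x

theorem isSymmUnimodal_gaussianReal (hs : 0 < sig) :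
    IsSymmUnimodal (gaussianReal 0 ⟨sig ^ 2, sq_nonneg sig⟩) :=
  ⟨fG sig, (continuous_fG hs).measurable, fun x => (fG_pos hs x).le, fG_neg,
    (fG_strictAntiOn hs).antitoneOn.mono Ioi_subset_Ici_self, gaussianReal_eq_withDensity_fG hs⟩

theorem FG_neg (hs : 0 < sig) (x : ℝ) : FG sig (-x) = 1 - FG sig x :=
  (isSymmUnimodal_gaussianReal hs).cdf_neg x

theorem tendsto_FG_atTop : Tendsto (FG sig) atTop (𝓝 1) := tendsto_cdf_atTop _

theorem FG_zero (hs : 0 < sig) : FG sig 0 = 1 / 2 := by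
  have := FG_neg hs 0
  rw [neg_zero] at this
  linarith

theorem half_lt_FG (hs : 0 < sig) {x : ℝ} (hx : 0 < x) : 1 / 2 < FG sig x := by
  have h1 := strictMono_of_hasDerivAt_pos (hasDerivAt_FG hs) (fG_pos hs) hx
  rwa [FG_zero hs] at h1

end Gauss

/-! ### Crossings and existence of the common tangent -/

section Compare

variable {lam sig : ℝ}

/-- The difference of the reciprocals of the Gaussian and Cauchy densities, as a function of the
square of the abscissa. -/
noncomputable def recipGap (lam sig t : ℝ) : ℝ :=
  √(2 * Real.pi * sig ^ 2) * Real.exp (t / (2 * sig ^ 2)) - lam * Real.pi * (1 + t / lam ^ 2)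

theorem fC_le_fG_iff (hl : 0 < lam) (hs : 0 < sig) (x : ℝ) :
    fC lam x ≤ fG sig x ↔ recipGap lam sig (x ^ 2) ≤ 0 := by
  rw [fC_eq_one_div, fG_eq_one_div, one_div_le_one_div (fC_denom_pos hl x) (fG_denom_pos hs x),
    recipGap, sub_nonpos, div_pow]

theorem fG_le_fC_iff (hl : 0 < lam) (hs : 0 < sig) (x : ℝ) :
    fG sig x ≤ fC lam x ↔ 0 ≤ recipGap lam sig (x ^ 2) := by
  rw [fC_eq_one_div, fG_eq_one_div, one_div_le_one_div (fG_denom_pos hs x) (fC_denom_pos hl x),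
    recipGap, sub_nonneg, div_pow]

/-- Strict convexity in `t`: an exponential minus an affine function. It is proved from the tangent
line of the exponential at `b`. -/
theorem recipGap_neg_of_mem_Ioo (hs : 0 < sig) {a b c : ℝ} (hab : a < b) (hbc : b < c)
    (ha : recipGap lam sig a ≤ 0) (hc : recipGap lam sig c ≤ 0) : recipGap lam sig b < 0 := by
  have hpi := Real.pi_pos
  have hB : 0 < √(2 * Real.pi * sig ^ 2) := by positivity
  have hβ : 0 < 1 / (2 * sig ^ 2) := by positivity
  have e (t : ℝ) : recipGap lam sig t = √(2 * Real.pi * sig ^ 2) *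
      Real.exp (t * (1 / (2 * sig ^ 2))) - lam * Real.pi * (1 + t * (1 / lam ^ 2)) := by
    simp only [recipGap, mul_one_div]
  rw [e] at ha hc ⊢
  set B := √(2 * Real.pi * sig ^ 2)
  set β := 1 / (2 * sig ^ 2)
  set A := lam * Real.pi
  set k := 1 / lam ^ 2
  have key (u : ℝ) (hu : u ≠ b) :
      Real.exp (b * β) * (1 + (u - b) * β) < Real.exp (u * β) := by
    have h1 : (u - b) * β + 1 < Real.exp ((u - b) * β) :=
      Real.add_one_lt_exp (mul_ne_zero (sub_ne_zero.2 hu) hβ.ne')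
    have h2 : Real.exp (u * β) = Real.exp (b * β) * Real.exp ((u - b) * β) := by
      rw [← Real.exp_add]; ring_nf
    rw [h2]
    have := Real.exp_pos (b * β)
    gcongr
    linarith
  -- The weights `c - b` and `b - a` express `b` as a convex combination of `a` and `c`, so the
  -- linear terms of the tangent cancel.
  have k1 := mul_lt_mul_of_pos_left (key a hab.ne) (mul_pos hB (sub_pos.2 hbc))
  have k2 := mul_lt_mul_of_pos_left (key c hbc.ne') (mul_pos hB (sub_pos.2 hab))
  have k3 := mul_nonpos_of_nonneg_of_nonpos (sub_pos.2 hbc).le ha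
  have k4 := mul_nonpos_of_nonneg_of_nonpos (sub_pos.2 hab).le hc
  have : (c - a) * (B * Real.exp (b * β) - A * (1 + b * k)) < 0 := by linarith
  exact (pos_iff_neg_of_mul_neg this).1 (by linarith)

theorem exists_forall_fG_lt_fC (hl : 0 < lam) (hs : 0 < sig) :
    ∃ T, 0 < T ∧ ∀ x, T ≤ x → fG sig x < fC lam x := by
  have hpi := Real.pi_pos
  have h1 : Tendsto (fun x : ℝ => Real.exp (x / (2 * sig ^ 2)) / x ^ 2) atTop atTop := by
    have h2 := (Real.tendsto_exp_div_pow_atTop 2).comp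
      (tendsto_id.atTop_div_const (show 0 < 2 * sig ^ 2 by positivity))
    have h3 := h2.atTop_mul_const (show 0 < ((2 * sig ^ 2) ^ 2)⁻¹ by positivity)
    refine h3.congr' ?_
    filter_upwards [eventually_gt_atTop 0] with x hx
    simp only [Function.comp, id]
    field_simp
  have h4 := h1.eventually_gt_atTop
    (lam * Real.pi * (1 + 1 / lam ^ 2) / √(2 * Real.pi * sig ^ 2))
  obtain ⟨T, hT⟩ := eventually_atTop.1 h4
  -- With `1 ≤ x`, the bound `x ≤ x ^ 2` carries the threshold over to `x ^ 2`, and `1` and `x ^ 2`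
  -- are both at most `x ^ 4`.
  refine ⟨max T 1, by positivity, fun x hx => ?_⟩
  have hx1 : 1 ≤ x := (le_max_right _ _).trans hx
  have hxx : x ≤ x ^ 2 := by nlinarith
  have h5 := hT (x ^ 2) (((le_max_left _ _).trans hx).trans hxx)
  rw [← not_le, fC_le_fG_iff hl hs, not_le, recipGap, sub_pos]
  rw [div_lt_div_iff₀ (by positivity) (by positivity)] at h5
  refine lt_of_le_of_lt ?_ (h5.trans_eq (mul_comm _ _))
  rw [mul_assoc (lam * Real.pi)]
  have h6 : 1 ≤ (x ^ 2) ^ 2 := one_le_pow₀ (one_le_pow₀ hx1)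
  have h7 : x ^ 2 ≤ (x ^ 2) ^ 2 := by nlinarith
  have : 1 + x ^ 2 / lam ^ 2 ≤ (1 + 1 / lam ^ 2) * (x ^ 2) ^ 2 := by
    rw [add_mul, one_mul, one_div_mul_eq_div]; gcongr
  gcongr

theorem hasDerivAt_FC_sub_FG (hl : 0 < lam) (hs : 0 < sig) (x : ℝ) :
    HasDerivAt (fun x => FC lam x - FG sig x) (fC lam x - fG sig x) x :=
  (hasDerivAt_FC hl x).sub (hasDerivAt_FG hs x)

theorem continuous_FC (hl : 0 < lam) : Continuous (FC lam) :=
  continuous_iff_continuousAt.2 fun x => (hasDerivAt_FC hl x).continuousAt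

theorem continuous_FG (hs : 0 < sig) : Continuous (FG sig) :=
  continuous_iff_continuousAt.2 fun x => (hasDerivAt_FG hs x).continuousAt

theorem tendsto_FC_sub_FG (hl : 0 < lam) :
    Tendsto (fun x => FC lam x - FG sig x) atTop (𝓝 0) := by
  simpa using (tendsto_FC_atTop hl).sub (tendsto_FG_atTop (sig := sig))

/-- The difference of the CDFs increases strictly to its limit `0`, hence is negative. -/
theorem FC_lt_FG_of_forall_fG_lt_fC (hl : 0 < lam) (hs : 0 < sig) {s : ℝ}
    (h : ∀ x, s < x → fG sig x < fC lam x) {x : ℝ} (hx : s ≤ x) : FC lam x < FG sig x := by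
  have hm : StrictMonoOn (fun x => FC lam x - FG sig x) (Ici s) := by
    refine strictMonoOn_of_hasDerivWithinAt_pos (convex_Ici s)
      ((continuous_FC hl).sub (continuous_FG hs)).continuousOn
      (fun y _ => (hasDerivAt_FC_sub_FG hl hs y).hasDerivWithinAt) fun y hy => ?_
    rw [interior_Ici] at hy
    exact sub_pos.2 (h y hy)
  have h1 : FC lam x - FG sig x < FC lam (x + 1) - FG sig (x + 1) :=
    hm (mem_Ici.2 hx) (mem_Ici.2 (by linarith)) (by linarith)
  have h2 : FC lam (x + 1) - FG sig (x + 1) ≤ 0 := by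
    refine ge_of_tendsto (tendsto_FC_sub_FG (sig := sig) hl) ?_
    filter_upwards [eventually_ge_atTop (x + 1)] with y hy
    exact hm.monotoneOn (mem_Ici.2 (by linarith)) (mem_Ici.2 (by linarith)) hy
  linarith

/-- The Cauchy CDF crosses the Gaussian CDF at most once on the right half-line. -/
theorem FC_lt_FG_of_le (hl : 0 < lam) (hs : 0 < sig) {u v : ℝ} (hu : 0 < u) (huv : u < v)
    (h : FC lam u ≤ FG sig u) : FC lam v < FG sig v := by
  by_contra! hv
  have hc : Continuous fun x => FC lam x - FG sig x := (continuous_FC hl).sub (continuous_FG hs)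
  -- The difference is `0` at `0`, nonpositive at `u` and nonnegative at `v`, so `recipGap` is
  -- nonpositive at some `s₁ ^ 2` and nonnegative at a later `s₂ ^ 2`. By convexity it is positive
  -- from there on, which forces the difference to be negative at `v`.
  obtain ⟨s₁, hs₁, e₁⟩ := exists_hasDerivAt_eq_slope _ _ hu hc.continuousOn
    fun x _ => hasDerivAt_FC_sub_FG hl hs x
  obtain ⟨s₂, hs₂, e₂⟩ := exists_hasDerivAt_eq_slope _ _ huv hc.continuousOn
    fun x _ => hasDerivAt_FC_sub_FG hl hs x
  have g₁ : recipGap lam sig (s₁ ^ 2) ≤ 0 := by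
    rw [← fC_le_fG_iff hl hs, ← sub_nonpos, e₁, FC_zero, FG_zero hs]
    exact div_nonpos_of_nonpos_of_nonneg (by linarith) (by linarith)
  have g₂ : 0 ≤ recipGap lam sig (s₂ ^ 2) := by
    rw [← fG_le_fC_iff hl hs, ← sub_nonneg, e₂]
    exact div_nonneg (by linarith) (by linarith)
  have hs₁0 : 0 < s₁ := hs₁.1
  have h12 : s₁ < s₂ := hs₁.2.trans hs₂.1
  refine absurd (FC_lt_FG_of_forall_fG_lt_fC hl hs (s := s₂) (fun x hx => ?_) hs₂.2.le) hv.not_gt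
  by_contra! hx'
  rw [fC_le_fG_iff hl hs] at hx'
  have hs₂0 : 0 < s₂ := hs₁0.trans h12
  have h23 : s₂ ^ 2 < x ^ 2 := by gcongr
  exact (recipGap_neg_of_mem_Ioo hs (by gcongr) h23 g₁ hx').not_ge g₂

/-- The difference `D` has a positive maximum at `y` and a negative minimum at a later `z`, where
the densities agree. Each Gaussian point over `[y, z]` is paired with the Cauchy point of equal
slope; the height of the former above the Cauchy tangent changes sign. -/
theorem exists_tangentPair (hl : 0 < lam) (hs : 0 < sig) {x₀ : ℝ} (hx₀ : 0 < x₀)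
    (h : FG sig x₀ < FC lam x₀) : ∃ x₁ x₂, IsTangentPair lam sig x₁ x₂ := by
  have hpi := Real.pi_pos
  set D : ℝ → ℝ := fun x => FC lam x - FG sig x with hD
  have hDc : Continuous D := (continuous_FC hl).sub (continuous_FG hs)
  have hD0 : D 0 = 0 := by simp [hD, FC_zero, FG_zero hs]
  have hDd (x : ℝ) : HasDerivAt D (fC lam x - fG sig x) x := hasDerivAt_FC_sub_FG hl hs x
  obtain ⟨T, hT0, hT⟩ := exists_forall_fG_lt_fC hl hs
  have htail {x : ℝ} (hx : T ≤ x) : D x < 0 :=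
    sub_neg.2 (FC_lt_FG_of_forall_fG_lt_fC hl hs (fun y hy => hT y hy.le) hx)
  have hx₀T : x₀ < T := by
    by_contra! hx
    exact absurd (htail hx) (sub_pos.2 h).not_gt
  obtain ⟨y, hy, hymax⟩ := isCompact_Icc.exists_isMaxOn (nonempty_Icc.2 hT0.le)
    (hDc.continuousOn (s := Icc 0 T))
  have hDy : 0 < D y := (sub_pos.2 h).trans_le (hymax ⟨hx₀.le, hx₀T.le⟩)
  have hy0 : 0 < y := lt_of_le_of_ne hy.1 fun e => by rw [← e, hD0] at hDy; exact hDy.false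
  have hyT : y < T := lt_of_le_of_ne hy.2 fun e => (htail e.ge).not_gt hDy
  have hfy : fC lam y = fG sig y :=
    sub_eq_zero.1 ((hymax.isLocalMax (Icc_mem_nhds hy0 hyT)).hasDerivAt_eq_zero (hDd y))
  -- Since `D T < 0` and `D` tends to `0`, some `M` has `D T < D M`; this keeps the minimum on `[y,
  -- M]` away from `M`.
  obtain ⟨M, hMT, hM⟩ := ((eventually_gt_atTop T).and
    ((tendsto_FC_sub_FG (sig := sig) hl).eventually_const_lt (htail le_rfl))).exists
  have hM : D T < D M := hM
  obtain ⟨z, hz, hzmin⟩ := isCompact_Icc.exists_isMinOn (nonempty_Icc.2 (hyT.trans hMT).le)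
    (hDc.continuousOn (s := Icc y M))
  have hzT : D z ≤ D T := hzmin ⟨hyT.le, hMT.le⟩
  have hDz : D z < 0 := hzT.trans_lt (htail le_rfl)
  have hyz : y < z := lt_of_le_of_ne hz.1 fun e => by rw [← e] at hDz; exact hDz.not_gt hDy
  have hzM : z < M := lt_of_le_of_ne hz.2 fun e => by rw [e] at hzT; exact hzT.not_gt hM
  have hfz : fC lam z = fG sig z :=
    sub_eq_zero.1 ((hzmin.isLocalMin (Icc_mem_nhds hyz hzM)).hasDerivAt_eq_zero (hDd z))
  -- `p x` is the abscissa at which the Cauchy CDF has the slope of the Gaussian CDF at `x`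
  set p : ℝ → ℝ := fun x => lam * √(1 / (lam * Real.pi * fG sig x) - 1) with hp
  have hp0 (x : ℝ) : 0 ≤ p x := by positivity
  have hpf (x : ℝ) (hx : y ≤ x) : fC lam (p x) = fG sig x := by
    -- The slope must not exceed the Cauchy peak for the square root in `p` to be genuine; beyond
    -- `y` this follows from `fC lam y = fG sig y`.
    have h1 : fG sig x ≤ fC lam 0 :=
      ((fG_strictAntiOn hs).antitoneOn hy0.le (hy0.le.trans hx) hx).trans
        (hfy.ge.trans ((fC_strictAntiOn hl).antitoneOn (mem_Ici.2 le_rfl) hy0.le hy0.le))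
    have hg := fG_pos hs x
    have h2 : 0 ≤ 1 / (lam * Real.pi * fG sig x) - 1 := by
      rw [sub_nonneg, le_div_iff₀ (by positivity), one_mul]
      have : fC lam 0 = 1 / (lam * Real.pi) := by simp [fC]
      rw [this, le_div_iff₀ (by positivity)] at h1
      linarith
    rw [fC_eq_one_div, hp]
    simp only
    rw [mul_div_cancel_left₀ _ hl.ne', Real.sq_sqrt h2]
    field_simp
    ring
  have hinj {a b : ℝ} (ha : 0 ≤ a) (hb : 0 ≤ b) (e : fC lam a = fC lam b) : a = b :=
    (fC_strictAntiOn hl).injOn ha hb e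
  have hpy : p y = y := hinj (hp0 y) hy0.le ((hpf y le_rfl).trans hfy.symm)
  have hpz : p z = z := hinj (hp0 z) (hy0.trans hyz).le ((hpf z hyz.le).trans hfz.symm)
  have hpc : Continuous p := by
    refine continuous_const.mul (Continuous.sqrt (Continuous.sub (continuous_const.div
      (continuous_const.mul (continuous_fG hs)) fun x => ?_) continuous_const))
    have := fG_pos hs x
    positivity
  have hFC := continuous_FC hl
  have hFG := continuous_FG hs
  have hfG := continuous_fG hs
  -- As `p` fixes `y` and `z`, the function `H` equals `-D` at both.
  set H : ℝ → ℝ := fun x => FG sig x - FC lam (p x) - fG sig x * (x - p x) with hH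
  have hHc : Continuous H := by fun_prop
  have hHy : H y < 0 := by
    simp only [hH, hpy, sub_self, mul_zero, sub_zero]
    have := hDy
    simp only [hD] at this
    linarith
  have hHz : 0 < H z := by
    simp only [hH, hpz, sub_self, mul_zero, sub_zero]
    have := hDz
    simp only [hD] at this
    linarith
  obtain ⟨w, hw, hw0⟩ := intermediate_value_Ioo hyz.le hHc.continuousOn ⟨hHy, hHz⟩
  have hw0 : FG sig w - FC lam (p w) - fG sig w * (w - p w) = 0 := hw0
  have hwpos : 0 < w := hy0.trans hw.1
  have hpw := hpf w hw.1.le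
  have hlt : p w < w := by
    by_contra! hle
    rcases hle.eq_or_lt with e | hlt
    · rw [← e] at hpw
      have hwz : w < z := hw.2
      have hyw : y < w := hw.1
      have h1 : y ^ 2 < w ^ 2 := by gcongr
      have h2 : w ^ 2 < z ^ 2 := by gcongr
      exact (recipGap_neg_of_mem_Ioo hs h1 h2 ((fC_le_fG_iff hl hs y).1 hfy.le)
        ((fC_le_fG_iff hl hs z).1 hfz.le)).not_ge ((fG_le_fC_iff hl hs w).1 hpw.ge)
    -- If `w < p w`, the common tangent puts Cauchy below Gaussian at `w` and above it at `p w`,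
    -- contrary to the single crossing.
    · have h1 := lt_tangent_of_strictAntiOn (hasDerivAt_FC hl) (fC_strictAntiOn hl) (hp0 w)
        hwpos.le hlt.ne
      have h2 := lt_tangent_of_strictAntiOn (hasDerivAt_FG hs) (fG_strictAntiOn hs) hwpos.le
        (hp0 w) hlt.ne'
      rw [hpw] at h1
      have h3 := FC_lt_FG_of_le hl hs hwpos hlt (by linarith)
      linarith
  refine ⟨p w, w, ?_, hlt, hpw, ?_⟩
  · refine lt_of_le_of_ne (hp0 w) fun e => ?_
    have h1 : fG sig w < fG sig y := fG_strictAntiOn hs hy0.le hwpos.le hw.1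
    have h2 := (fC_strictAntiOn hl).antitoneOn (mem_Ici.2 le_rfl) (mem_Ici.2 hy0.le) hy0.le
    rw [← e] at hpw
    linarith
  · rw [eq_div_iff (by linarith)]
    linarith

end Compare

/-! ### The Cauchy-Gaussian overbound -/

section Overbound

variable {lam sig x₁ x₂ : ℝ}

theorem IsTangentPair.FG_eq (h : IsTangentPair lam sig x₁ x₂) :
    FG sig x₂ = fC lam x₁ * (x₂ - x₁) + FC lam x₁ := by
  obtain ⟨-, h12, e1, e2⟩ := h
  rw [eq_div_iff (by linarith), ← e1] at e2
  linarith

theorem IsTangentPair.FG_le_TR (hs : 0 < sig) (h : IsTangentPair lam sig x₁ x₂) {x : ℝ}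
    (hx : 0 ≤ x) : FG sig x ≤ TR lam x₁ x := by
  have h2 : 0 < x₂ := h.1.trans h.2.1
  have e := h.FG_eq
  rw [TR]
  rcases eq_or_ne x x₂ with rfl | hne
  · exact e.le
  · have := lt_tangent_of_strictAntiOn (hasDerivAt_FG hs) (fG_strictAntiOn hs) h2.le hx hne
    rw [← h.2.2.1] at this
    linarith

theorem FC_le_TR (hl : 0 < lam) (hx₁ : 0 ≤ x₁) {x : ℝ} (hx : 0 ≤ x) :
    FC lam x ≤ TR lam x₁ x := by
  rw [TR]
  rcases eq_or_ne x x₁ with rfl | hne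
  · simp
  · linarith [lt_tangent_of_strictAntiOn (hasDerivAt_FC hl) (fC_strictAntiOn hl) hx₁ hx hne]

/-- At `x₁` the tangent touches the Cauchy CDF, while the Gaussian CDF is strictly below it away
from `x₂`. With the mirror statement at `x₂`, the single crossing lies between the contact points.
-/
theorem IsTangentPair.FG_lt_FC (hs : 0 < sig) (h : IsTangentPair lam sig x₁ x₂) :
    FG sig x₁ < FC lam x₁ := by
  have := lt_tangent_of_strictAntiOn (hasDerivAt_FG hs) (fG_strictAntiOn hs)
    (h.1.trans h.2.1).le h.1.le h.2.1.ne
  rw [← h.2.2.1] at this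
  linarith [h.FG_eq]

theorem IsTangentPair.FC_lt_FG (hl : 0 < lam) (h : IsTangentPair lam sig x₁ x₂) :
    FC lam x₂ < FG sig x₂ := by
  have := lt_tangent_of_strictAntiOn (hasDerivAt_FC hl) (fC_strictAntiOn hl)
    h.1.le (h.1.trans h.2.1).le h.2.1.ne'
  linarith [h.FG_eq]

theorem IsTangentPair.FG_le_FC_of_le (hl : 0 < lam) (hs : 0 < sig)
    (h : IsTangentPair lam sig x₁ x₂) {x : ℝ} (hx0 : 0 < x) (hx : x ≤ x₁) :
    FG sig x ≤ FC lam x := by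
  rcases hx.eq_or_lt with rfl | hlt
  · exact (h.FG_lt_FC hs).le
  · by_contra! hc
    exact (FC_lt_FG_of_le hl hs hx0 hlt hc.le).not_gt (h.FG_lt_FC hs)

theorem IsTangentPair.FC_le_FG_of_ge (hl : 0 < lam) (hs : 0 < sig)
    (h : IsTangentPair lam sig x₁ x₂) {x : ℝ} (hx : x₂ ≤ x) : FC lam x ≤ FG sig x := by
  rcases hx.eq_or_lt with rfl | hlt
  · exact (h.FC_lt_FG hl).le
  · exact (FC_lt_FG_of_le hl hs (h.1.trans h.2.1) hlt (h.FC_lt_FG hl).le).le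

/-- `Overbounds` splits by the value of `G`; `hhalf` and symmetry turn this into a split by the sign
of `x`. -/
theorem overbounds_of_forall_pos {F G : ℝ → ℝ} (hF : ∀ x, F (-x) = 1 - F x)
    (hG : ∀ x, G (-x) = 1 - G x) (hhalf : ∀ x > 0, 1 / 2 < G x) (hle : ∀ x > 0, F x ≤ G x) :
    Overbounds F G := by
  have hF0 := hF 0
  have hG0 := hG 0
  rw [neg_zero] at hF0 hG0
  refine ⟨fun x hx => ?_, fun x hx => hle x ?_⟩
  · rcases lt_trichotomy x 0 with h | rfl | h
    · have := hle _ (neg_pos.2 h)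
      rw [hF, hG] at this
      linarith
    · linarith
    · exact absurd (hhalf x h) hx.not_gt
  · by_contra! h
    rcases h.eq_or_lt with rfl | h
    · linarith
    · have := hhalf _ (neg_pos.2 h)
      rw [hG] at this
      linarith

/-- A tangent pair exists exactly when the Cauchy CDF fails to overbound the Gaussian CDF. -/
theorem exists_tangentPair_iff (hl : 0 < lam) (hs : 0 < sig) :
    (∃ x₁ x₂, IsTangentPair lam sig x₁ x₂) ↔ ¬ Overbounds (FC lam) (FG sig) := by
  constructor
  · rintro ⟨x₁, x₂, h⟩ ho
    exact (ho.2 x₁ (half_lt_FG hs h.1)).not_gt (h.FG_lt_FC hs)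
  · intro ho
    by_contra hne
    have key {x : ℝ} (hx : 0 < x) : FC lam x ≤ FG sig x := by
      by_contra! hlt
      exact hne (exists_tangentPair hl hs hx hlt)
    exact ho (overbounds_of_forall_pos FC_neg (FG_neg hs) (fun _ => half_lt_FG hs) fun _ => key)

theorem TL_neg (x : ℝ) : TL lam x₁ (-x) = 1 - TR lam x₁ x := by
  rw [TL, TR, FC_neg]; ring

/-- Reflection exchanges minimum with maximum and the left segment with the right one. -/
theorem Fob_neg (hs : 0 < sig) {x : ℝ} (hx : 0 < x) :
    Fob lam sig x₁ x₂ (-x) = 1 - Fob lam sig x₁ x₂ x := by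
  have hc : (-x₂ ≤ -x ∧ -x ≤ -x₁) ↔ (x₁ ≤ x ∧ x ≤ x₂) := by
    rw [neg_le_neg_iff, neg_le_neg_iff, and_comm]
  have hm (a b : ℝ) : min (1 - a) (1 - b) = 1 - max a b := min_sub_sub_left 1 a b
  simp only [Fob, if_pos (neg_nonpos.2 hx.le), if_neg hx.not_ge, hc, TL_neg, FC_neg, FG_neg hs, hm]
  split_ifs <;> rfl

theorem IsTangentPair.Fob_eq_FC (hl : 0 < lam) (hs : 0 < sig)
    (h : IsTangentPair lam sig x₁ x₂) {x : ℝ} (hx : |x| ≤ x₁) :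
    Fob lam sig x₁ x₂ x = FC lam x := by
  have key {x : ℝ} (h0 : 0 < x) (hx : x ≤ x₁) : Fob lam sig x₁ x₂ x = FC lam x := by
    have h1 := h.FG_le_FC_of_le hl hs h0 hx
    rw [Fob, if_neg h0.not_ge]
    split_ifs with hc
    · have : x = x₁ := le_antisymm hx hc.1
      subst this
      have : TR lam x x = FC lam x := by simp [TR]
      rw [this, max_eq_left h1, max_self]
    · exact max_eq_left h1
  have hx' := abs_le.1 hx
  rcases lt_trichotomy x 0 with hx0 | rfl | hx0
  · rw [← neg_neg x, Fob_neg hs (neg_pos.2 hx0), FC_neg, key (neg_pos.2 hx0) (by linarith)]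
  · have hc : ¬ (-x₂ ≤ 0 ∧ 0 ≤ -x₁) := fun hc => by linarith [h.1, hc.2]
    rw [Fob, if_pos le_rfl, if_neg hc, FC_zero, FG_zero hs, min_self]
  · exact key hx0 hx'.2

theorem IsTangentPair.Fob_eq_TR (hl : 0 < lam) (hs : 0 < sig)
    (h : IsTangentPair lam sig x₁ x₂) {x : ℝ} (h1 : x₁ ≤ x) (h2 : x ≤ x₂) :
    Fob lam sig x₁ x₂ x = TR lam x₁ x := by
  have h0 : 0 < x := h.1.trans_le h1
  rw [Fob, if_neg h0.not_ge, if_pos ⟨h1, h2⟩, max_eq_left (h.FG_le_TR hs h0.le),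
    max_eq_right (FC_le_TR hl h.1.le h0.le)]

theorem IsTangentPair.Fob_eq_TL (hl : 0 < lam) (hs : 0 < sig)
    (h : IsTangentPair lam sig x₁ x₂) {x : ℝ} (h1 : -x₂ ≤ x) (h2 : x ≤ -x₁) :
    Fob lam sig x₁ x₂ x = TL lam x₁ x := by
  rw [← neg_neg x, Fob_neg hs (by linarith [h.1]), TL_neg,
    h.Fob_eq_TR hl hs (by linarith) (by linarith)]

theorem IsTangentPair.Fob_eq_FG (hl : 0 < lam) (hs : 0 < sig)
    (h : IsTangentPair lam sig x₁ x₂) {x : ℝ} (hx : x₂ ≤ |x|) :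
    Fob lam sig x₁ x₂ x = FG sig x := by
  have h02 : 0 < x₂ := h.1.trans h.2.1
  have key {x : ℝ} (hx : x₂ ≤ x) : Fob lam sig x₁ x₂ x = FG sig x := by
    have h0 : 0 < x := h02.trans_le hx
    have h1 := h.FC_le_FG_of_ge hl hs hx
    rw [Fob, if_neg h0.not_ge]
    split_ifs with hc
    · have : x = x₂ := le_antisymm hc.2 hx
      subst this
      have : TR lam x₁ x = FG sig x := by rw [h.FG_eq, TR]
      rw [this, max_self, max_eq_right h1]
    · exact max_eq_right h1
  rcases le_abs.1 hx with hx | hx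
  · exact key hx
  · rw [← neg_neg x, Fob_neg hs (h02.trans_le hx), FG_neg hs, key hx]

/-- The density of the Cauchy-Gaussian overbound. -/
noncomputable def fob (lam sig x₁ x : ℝ) : ℝ :=
  max (fC lam x) (fC lam x₁) + min (fG sig x) (fC lam x₁) - fC lam x₁

theorem fC_abs (x : ℝ) : fC lam |x| = fC lam x := by
  rcases abs_choice x with h | h <;> rw [h]
  exact fC_neg x

theorem fG_abs (x : ℝ) : fG sig |x| = fG sig x := by
  rcases abs_choice x with h | h <;> rw [h]
  exact fG_neg x

/-- Both densities pass the level `fC lam x₁`, Cauchy at `x₁` and Gaussian at `x₂`, so on each piece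
at least one truncation in `fob` equals that level and cancels. The closed formula shows continuity,
evenness and monotonicity without cases. -/
theorem fob_eq_fC (hl : 0 < lam) (hs : 0 < sig) (h : IsTangentPair lam sig x₁ x₂) {x : ℝ}
    (hx : |x| ≤ x₁) : fob lam sig x₁ x = fC lam x := by
  have h1 := (fC_strictAntiOn hl).antitoneOn (mem_Ici.2 (abs_nonneg x)) (mem_Ici.2 h.1.le) hx
  have h2 := (fG_strictAntiOn hs).antitoneOn (mem_Ici.2 (abs_nonneg x))
    (mem_Ici.2 (h.1.trans h.2.1).le) (hx.trans h.2.1.le)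
  rw [fC_abs] at h1
  rw [fG_abs, ← h.2.2.1] at h2
  rw [fob, max_eq_left h1, min_eq_right h2]
  ring

theorem fob_eq_slope (hl : 0 < lam) (hs : 0 < sig) (h : IsTangentPair lam sig x₁ x₂) {x : ℝ}
    (hx₁ : x₁ ≤ |x|) (hx₂ : |x| ≤ x₂) : fob lam sig x₁ x = fC lam x₁ := by
  have h1 := (fC_strictAntiOn hl).antitoneOn (mem_Ici.2 h.1.le) (mem_Ici.2 (abs_nonneg x)) hx₁
  have h2 := (fG_strictAntiOn hs).antitoneOn (mem_Ici.2 (abs_nonneg x))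
    (mem_Ici.2 (h.1.trans h.2.1).le) hx₂
  rw [fC_abs] at h1
  rw [fG_abs, ← h.2.2.1] at h2
  rw [fob, max_eq_right h1, min_eq_right h2]
  ring

theorem fob_eq_fG (hl : 0 < lam) (hs : 0 < sig) (h : IsTangentPair lam sig x₁ x₂) {x : ℝ}
    (hx : x₂ ≤ |x|) : fob lam sig x₁ x = fG sig x := by
  have h1 := (fC_strictAntiOn hl).antitoneOn (mem_Ici.2 h.1.le) (mem_Ici.2 (abs_nonneg x))
    (h.2.1.le.trans hx)
  have h2 := (fG_strictAntiOn hs).antitoneOn (mem_Ici.2 (h.1.trans h.2.1).le)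
    (mem_Ici.2 (abs_nonneg x)) hx
  rw [fC_abs] at h1
  rw [fG_abs, ← h.2.2.1] at h2
  rw [fob, max_eq_right h1, min_eq_left h2]
  ring

theorem IsTangentPair.continuous_Fob (hl : 0 < lam) (hs : 0 < sig)
    (h : IsTangentPair lam sig x₁ x₂) : Continuous (Fob lam sig x₁ x₂) := by
  have hFC := continuous_FC hl
  have hFG := continuous_FG hs
  -- Clamping to `[-r, r]` writes `Fob` as one sum of the Cauchy, Gaussian and linear increments, a
  -- visibly continuous expression.
  set c : ℝ → ℝ → ℝ := fun r x => max (-r) (min x r) with hc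
  have hcc (r : ℝ) : Continuous (c r) := by fun_prop
  have cmid {r x : ℝ} (h1 : -r ≤ x) (h2 : x ≤ r) : c r x = x := by simp [hc, h1, h2]
  have cright {r x : ℝ} (h1 : 0 < r) (h2 : r ≤ x) : c r x = r := by simp [hc, h2, h1.le]
  have cleft {r x : ℝ} (h1 : 0 < r) (h2 : x ≤ -r) : c r x = -r := by
    simp only [hc]
    rw [min_eq_left (by linarith), max_eq_left h2]
  have e : Fob lam sig x₁ x₂ = fun x => FC lam (c x₁ x) + (FG sig x - FG sig (c x₂ x)) +
      fC lam x₁ * (c x₂ x - c x₁ x) := by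
    ext x
    have h1 := h.1
    have h12 := h.2.1
    have h2 : 0 < x₂ := h1.trans h12
    have hG := h.FG_eq
    rcases le_total x (-x₂) with k1 | k1
    · rw [h.Fob_eq_FG hl hs (le_abs.2 (Or.inr (by linarith))), cleft h1 (by linarith),
        cleft h2 k1, FC_neg, FG_neg hs]
      linarith
    rcases le_total x (-x₁) with k2 | k2
    · rw [h.Fob_eq_TL hl hs k1 k2, cleft h1 k2, cmid k1 (by linarith), TL]
      ring
    rcases le_total x x₁ with k3 | k3
    · rw [h.Fob_eq_FC hl hs (abs_le.2 ⟨k2, k3⟩), cmid k2 k3, cmid k1 (by linarith)]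
      ring
    rcases le_total x x₂ with k4 | k4
    · rw [h.Fob_eq_TR hl hs k3 k4, cright h1 k3, cmid k1 k4, TR]
      ring
    · rw [h.Fob_eq_FG hl hs (le_abs.2 (Or.inl k4)), cright h1 k3, cright h2 k4]
      linarith
  rw [e]
  fun_prop

theorem IsTangentPair.hasDerivAt_Fob (hl : 0 < lam) (hs : 0 < sig)
    (h : IsTangentPair lam sig x₁ x₂) {x : ℝ} (hx : x ∉ ({-x₂, -x₁, x₁, x₂} : Set ℝ)) :
    HasDerivAt (Fob lam sig x₁ x₂) (fob lam sig x₁ x) x := by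
  simp only [mem_insert_iff, mem_singleton_iff, not_or] at hx
  obtain ⟨n1, n2, n3, n4⟩ := hx
  have h1 := h.1
  have h12 := h.2.1
  rcases lt_or_gt_of_ne n1 with k1 | k1
  · rw [fob_eq_fG hl hs h (le_abs.2 (Or.inr (by linarith)))]
    refine (hasDerivAt_FG hs x).congr_of_eventuallyEq ?_
    filter_upwards [Iio_mem_nhds k1] with y (hy : y < -x₂)
    exact h.Fob_eq_FG hl hs (le_abs.2 (Or.inr (by linarith)))
  rcases lt_or_gt_of_ne n2 with k2 | k2
  · rw [fob_eq_slope hl hs h (le_abs.2 (Or.inr (by linarith))) (abs_le.2 ⟨k1.le, by linarith⟩)]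
    have hT : HasDerivAt (TL lam x₁) (fC lam x₁) x :=
      ((((hasDerivAt_id x).add_const x₁).const_mul (fC lam x₁)).add_const
        (FC lam (-x₁))).congr_deriv (mul_one _)
    refine hT.congr_of_eventuallyEq ?_
    filter_upwards [Ioo_mem_nhds k1 k2] with y hy
    exact h.Fob_eq_TL hl hs hy.1.le hy.2.le
  rcases lt_or_gt_of_ne n3 with k3 | k3
  · rw [fob_eq_fC hl hs h (abs_le.2 ⟨k2.le, k3.le⟩)]
    refine (hasDerivAt_FC hl x).congr_of_eventuallyEq ?_
    filter_upwards [Ioo_mem_nhds k2 k3] with y hy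
    exact h.Fob_eq_FC hl hs (abs_le.2 ⟨hy.1.le, hy.2.le⟩)
  rcases lt_or_gt_of_ne n4 with k4 | k4
  · rw [fob_eq_slope hl hs h (le_abs.2 (Or.inl k3.le)) (abs_le.2 ⟨k1.le, k4.le⟩)]
    have hT : HasDerivAt (TR lam x₁) (fC lam x₁) x :=
      ((((hasDerivAt_id x).sub_const x₁).const_mul (fC lam x₁)).add_const
        (FC lam x₁)).congr_deriv (mul_one _)
    refine hT.congr_of_eventuallyEq ?_
    filter_upwards [Ioo_mem_nhds k3 k4] with y hy
    exact h.Fob_eq_TR hl hs hy.1.le hy.2.le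
  · rw [fob_eq_fG hl hs h (le_abs.2 (Or.inl k4.le))]
    refine (hasDerivAt_FG hs x).congr_of_eventuallyEq ?_
    filter_upwards [Ioi_mem_nhds k4] with y (hy : x₂ < y)
    exact h.Fob_eq_FG hl hs (le_abs.2 (Or.inl hy.le))

theorem IsTangentPair.isSymmUnimodalCDF_Fob (hl : 0 < lam) (hs : 0 < sig)
    (h : IsTangentPair lam sig x₁ x₂) : IsSymmUnimodalCDF (Fob lam sig x₁ x₂) := by
  have hfC := continuous_fC hl
  have hfG := continuous_fG hs
  have hc : Continuous (fob lam sig x₁) := by unfold fob; fun_prop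
  have h0 (x : ℝ) : 0 ≤ fob lam sig x₁ x := by
    have h1 : 0 ≤ min (fG sig x) (fC lam x₁) := le_min (fG_pos hs x).le (fC_pos hl x₁).le
    have h2 := le_max_right (fC lam x) (fC lam x₁)
    rw [fob]
    linarith
  have hbot : Tendsto (Fob lam sig x₁ x₂) atBot (𝓝 0) := by
    refine (tendsto_cdf_atBot (gaussianReal 0 ⟨sig ^ 2, sq_nonneg sig⟩)).congr' ?_
    filter_upwards [eventually_le_atBot (-x₂)] with x hx
    exact (h.Fob_eq_FG hl hs (le_abs.2 (Or.inr (by linarith)))).symm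
  have htop : Tendsto (Fob lam sig x₁ x₂) atTop (𝓝 1) := by
    refine (tendsto_FG_atTop (sig := sig)).congr' ?_
    filter_upwards [eventually_ge_atTop x₂] with x hx
    exact (h.Fob_eq_FG hl hs (le_abs.2 (Or.inl hx))).symm
  obtain ⟨hp, hF⟩ := withDensity_cdf_of_hasDerivAt (Set.toFinite _).countable
    (h.continuous_Fob hl hs) hc h0 (fun x hx => h.hasDerivAt_Fob hl hs hx) hbot htop
  refine ⟨_, hp, ⟨fob lam sig x₁, hc.measurable, h0, fun x => ?_, fun x hx y hy hxy => ?_, rfl⟩,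
    hF⟩
  · simp only [fob, fC_neg, fG_neg]
  · have h1 := (fC_strictAntiOn hl).antitoneOn (Ioi_subset_Ici_self hx)
      (Ioi_subset_Ici_self hy) hxy
    have h2 := (fG_strictAntiOn hs).antitoneOn (Ioi_subset_Ici_self hx)
      (Ioi_subset_Ici_self hy) hxy
    simp only [fob]
    gcongr

/-- Only the segment needs unimodality of `μ`: its ends lie on the Cauchy and Gaussian CDFs, so the
concave `cdf μ` dominates it in between. -/
theorem IsTangentPair.Fob_le_cdf (hl : 0 < lam) (hs : 0 < sig)
    (h : IsTangentPair lam sig x₁ x₂) {μ : Measure ℝ} [IsProbabilityMeasure μ]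
    (hμ : IsSymmUnimodal μ) (hC : ∀ x > 0, FC lam x ≤ cdf μ x)
    (hG : ∀ x > 0, FG sig x ≤ cdf μ x) {x : ℝ} (hx : 0 < x) :
    Fob lam sig x₁ x₂ x ≤ cdf μ x := by
  have h2 : 0 < x₂ := h.1.trans h.2.1
  rcases le_total x x₁ with k1 | k1
  · rw [h.Fob_eq_FC hl hs (by rwa [abs_of_pos hx])]
    exact hC x hx
  rcases le_total x x₂ with k2 | k2
  · rw [h.Fob_eq_TR hl hs k1 k2]
    have := hμ.line_le_cdf (k := fC lam x₁) (c := FC lam x₁ - fC lam x₁ * x₁) h.1 k1 k2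
      (by linarith [hC x₁ h.1]) (by linarith [hG x₂ h2, h.FG_eq])
    rw [TR]
    linarith
  · rw [h.Fob_eq_FG hl hs (by rwa [abs_of_pos hx])]
    exact hG x hx

/-! ### Projection to the position domain -/

theorem IsSymmUnimodal.cdf_zero {μ : Measure ℝ} [IsProbabilityMeasure μ]
    (hμ : IsSymmUnimodal μ) : cdf μ 0 = 1 / 2 := by
  have := hμ.cdf_neg 0
  rw [neg_zero] at this
  linarith

/-- For symmetric unimodal distributions a comparison of the CDFs on the right half-line is a
comparison of peakedness. -/
theorem IsSymmUnimodal.peakedLE {μ' μ : Measure ℝ} [IsProbabilityMeasure μ']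
    [IsProbabilityMeasure μ] (h' : IsSymmUnimodal μ') (h : IsSymmUnimodal μ)
    (hle : ∀ x > 0, cdf μ' x ≤ cdf μ x) : PeakedLE μ' μ := by
  intro t
  rw [h'.measure_Icc, h.measure_Icc]
  rcases lt_trichotomy t 0 with ht | rfl | ht
  · rw [ENNReal.ofReal_of_nonpos]
    · exact zero_le
    · linarith [monotone_cdf μ' ht.le, h'.cdf_zero]
  · rw [h'.cdf_zero, h.cdf_zero]
  · exact ENNReal.ofReal_le_ofReal (by linarith [hle t ht])

theorem IsSymmUnimodalCDF.isSymmUnimodal {F : ℝ → ℝ} (hF : IsSymmUnimodalCDF F)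
    {ν : Measure ℝ} [IsProbabilityMeasure ν] (hν : ∀ x, cdf ν x = F x) : IsSymmUnimodal ν := by
  obtain ⟨ρ, _, hsu, hρ⟩ := hF
  have : ν = ρ := Measure.eq_of_cdf ν ρ (StieltjesFunction.ext fun x => by rw [hν, hρ])
  rwa [this]

/-- Peakedness survives projection to the position domain. -/
theorem overbounds_projected {Ω : Type*} [MeasurableSpace Ω] {P : Measure Ω}
    [IsProbabilityMeasure P] {N : ℕ} {ε : Fin N → Ω → ℝ} (hmeas : ∀ i, Measurable (ε i))
    (hind : iIndepFun ε P) (S : Fin N → ℝ) (ν : Fin N → Measure ℝ)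
    [∀ i, IsProbabilityMeasure (ν i)] (hε : ∀ i, CenteredDecreasing (P.map (ε i)))
    (hν : ∀ i, CenteredDecreasing (ν i)) (hp : ∀ i, PeakedLE (ν i) (P.map (ε i))) :
    Overbounds (cdf (projected S ν)) (cdf (P.map fun ω => ∑ i, S i * ε i ω)) := by
  have hprob (i : Fin N) : IsProbabilityMeasure (P.map (ε i)) :=
    Measure.isProbabilityMeasure_map (hmeas i).aemeasurable
  have hprobS (i : Fin N) : IsProbabilityMeasure ((P.map (ε i)).map fun x => S i * x) :=
    Measure.isProbabilityMeasure_map (by fun_prop)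
  have hprobν (i : Fin N) : IsProbabilityMeasure ((ν i).map fun x => |S i| * x) :=
    Measure.isProbabilityMeasure_map (by fun_prop)
  have hsum : P.map (fun ω => ∑ i, S i * ε i ω) =
      convN N fun i => (P.map (ε i)).map fun x => S i * x := by
    rw [map_sum_eq_convN P N (fun i ω => S i * ε i ω) (fun i => (hmeas i).const_mul _)
      (hind.comp (fun i x => S i * x) fun i => by fun_prop)]
    congr 1
    ext1 i
    rw [Measure.map_map (by fun_prop) (hmeas i)]
    rfl
  rw [hsum, projected]
  have c1 (i : Fin N) := (hε i).map_mul (S i)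
  have c2 (i : Fin N) := (hν i).map_mul |S i|
  exact (peakedLE_convN N _ _ c2 c1 fun i => (hp i).map_mul (S i)).overbounds
    (centeredDecreasing_convN N _ c2) (centeredDecreasing_convN N _ c1)

end Overbound

end CauchyGaussian

open MeasureTheory ProbabilityTheory CauchyGaussian in
theorem mainTheorem1 {Ω : Type*} [MeasurableSpace Ω] (P : Measure Ω) [IsProbabilityMeasure P]
    {N : ℕ} (ε : Fin N → Ω → ℝ) (hmeas : ∀ i, Measurable (ε i)) (hind : iIndepFun ε P)
    (hsu : ∀ i, IsSymmUnimodal (P.map (ε i)))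
    (S sig lam : Fin N → ℝ)
    (hsig : ∀ i, IsOptimalGaussianScale (cdf (P.map (ε i))) (sig i))
    (hlam : ∀ i, IsOptimalCauchyScale (cdf (P.map (ε i))) (sig i) (lam i)) :
    -- the tangential link exists unless the Cauchy model already overbounds the Gaussian one
    (∀ i, (∃ x₁ x₂, IsTangentPair (lam i) (sig i) x₁ x₂) ↔
      ¬ Overbounds (FC (lam i)) (FG (sig i))) ∧
    ∀ x₁ x₂ : Fin N → ℝ, (∀ i, IsTangentPair (lam i) (sig i) (x₁ i) (x₂ i)) →
      (∀ i,
        -- Cauchy core, tangential segments, Gaussian tails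
        ((∀ x, |x| ≤ x₁ i → Fob (lam i) (sig i) (x₁ i) (x₂ i) x = FC (lam i) x) ∧
          (∀ x, x₁ i ≤ x → x ≤ x₂ i →
            Fob (lam i) (sig i) (x₁ i) (x₂ i) x = TR (lam i) (x₁ i) x) ∧
          (∀ x, -x₂ i ≤ x → x ≤ -x₁ i →
            Fob (lam i) (sig i) (x₁ i) (x₂ i) x = TL (lam i) (x₁ i) x) ∧
          (∀ x, x₂ i ≤ |x| → Fob (lam i) (sig i) (x₁ i) (x₂ i) x = FG (sig i) x)) ∧
        IsSymmUnimodalCDF (Fob (lam i) (sig i) (x₁ i) (x₂ i)) ∧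
        Overbounds (Fob (lam i) (sig i) (x₁ i) (x₂ i)) (cdf (P.map (ε i)))) ∧
      -- the overbound is preserved by projection to the position domain
      ∀ ν : Fin N → Measure ℝ,
        (∀ i, IsProbabilityMeasure (ν i) ∧
          ∀ x, cdf (ν i) x = Fob (lam i) (sig i) (x₁ i) (x₂ i) x) →
        Overbounds (cdf (projected S ν)) (cdf (P.map (fun ω => ∑ i, S i * ε i ω))) := by
  have hl (i : Fin N) : 0 < lam i := (hlam i).1.1
  have hs (i : Fin N) : 0 < sig i := (hsig i).1.1
  have hprob (i : Fin N) : IsProbabilityMeasure (P.map (ε i)) :=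
    Measure.isProbabilityMeasure_map (hmeas i).aemeasurable
  refine ⟨fun i => exists_tangentPair_iff (hl i) (hs i), fun x₁ x₂ ht => ?_⟩
  have hsuF (i : Fin N) := (ht i).isSymmUnimodalCDF_Fob (hl i) (hs i)
  have hle (i : Fin N) (x : ℝ) (hx : x > 0) :
      Fob (lam i) (sig i) (x₁ i) (x₂ i) x ≤ cdf (P.map (ε i)) x :=
    (ht i).Fob_le_cdf (hl i) (hs i) (hsu i) (hlam i).1.2.2.1 (hsig i).1.2.2 hx
  refine ⟨fun i => ⟨⟨fun x => (ht i).Fob_eq_FC (hl i) (hs i),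
    fun x => (ht i).Fob_eq_TR (hl i) (hs i), fun x => (ht i).Fob_eq_TL (hl i) (hs i),
    fun x => (ht i).Fob_eq_FG (hl i) (hs i)⟩, hsuF i, ?_⟩, fun ν hν => ?_⟩
  · obtain ⟨ρ, _, hρ, hρF⟩ := hsuF i
    refine overbounds_of_forall_pos (fun x => ?_) (hsu i).cdf_neg (fun x hx => ?_) (hle i)
    -- Symmetry for every `x`, including `0`, is read off from the measure `ρ`.
    · rw [← hρF, ← hρF, hρ.cdf_neg]
    · exact (half_lt_FC (hl i) hx).trans_le ((hlam i).1.2.2.1 x hx)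
  · have (i : Fin N) : IsProbabilityMeasure (ν i) := (hν i).1
    have hsuν (i : Fin N) := (hsuF i).isSymmUnimodal (hν i).2
    refine overbounds_projected hmeas hind S ν (fun i => (hsu i).centeredDecreasing)
      (fun i => (hsuν i).centeredDecreasing) fun i => (hsuν i).peakedLE (hsu i) fun x hx => ?_
    rw [(hν i).2]
    exact hle i x hx
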